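/- Let $\mathbb{E}$ be a finite-dimensional real inner product space with induced norm $\|\cdot\|$, let $\beta\ge 0$, $\mu>0$, $L>0$, and let $h,R,E:\mathbb{E}\to(-\infty,+\infty]$. Write $\operatorname{dom} f=\{f<+\infty\}$, $f_\beta:=\beta R+E$, $R^*(y):=\sup_x(\langle x,y\rangle-R(x))$, let $\partial R$ be the convex subdifferential and $\operatorname{dom}\partial R=\{x:\partial R(x)\ne\emptyset\}$, and let $$D_h(x,y)=h(x)-h(y)-\langle\nabla h(y),x-y\rangle,\qquad D_R^{q}(x,y)=R(x)-R(y)-\langle q,x-y\rangle\ \ (q\in\partial R(y)),$$ $$\alpha(h)=\inf\{D_h(x,y)/D_h(y,x):x,y\in\operatorname{int}\operatorname{dom}h,\ x\neq y\}.$$ Assume: 1. $h$ is of Legendre type: it is proper, lower semicontinuous (lsc) and convex, $\operatorname{int}\operatorname{dom}h\neq\emptyset$, $h$ is differentiable and strictly convex on $\operatorname{int}\operatorname{dom}h$, and $\|\nabla h(u^k)\|\to\infty$ whenever $u^k\in\operatorname{int}\operatorname{dom}h$ converges to a boundary point of $\operatorname{dom}h$. Moreover, $h$ is strongly convex on $\operatorname{dom}h$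 and $\overline{\operatorname{dom}h}=\operatorname{dom}h$. 2. $R\ge 0$ is proper, lsc and convex, $\operatorname{int}\operatorname{dom}h\subset\operatorname{dom}\partial R$, $\operatorname{dom}R\cap\operatorname{int}\operatorname{dom}h\neq\emptyset$, and for every bounded $U\subset\mathbb{E}$ there is $C>0$ with $\|q\|\le C$ for all $x\in U$, $q\in\partial R(x)$. 3. $E$ is proper and lsc, $\operatorname{dom}h\subset\operatorname{dom}E$, $E$ is differentiable on $\operatorname{int}\operatorname{dom}h$ and continuous on $\operatorname{dom}h$, and $Lh-E$ is convex on $\operatorname{int}\operatorname{dom}h$. ($E$ need not be convex.) 4. $\inf_{\operatorname{dom}h}f_\beta>-\infty$. 5. If $u^k\in\operatorname{int}\operatorname{dom}h$ and $u^k\to z\in\operatorname{dom}h$, then $D_h(z,u^k)\to0$ and $D_R^{q^k}(z,u^k)\to0$ for any $q^k\in\partial R(u^k)$. 6. For $f=h$ and $f=E$: $f$ is differentiable on $\operatorname{int}\operatorname{dom}f$ and $\nabla f$ is Lipschitz continuous on every bounded subset of $\operatorname{int}\operatorname{dom}f$. 7. The function $$F_{\beta,\mu}(x,y)=E(x)+(\beta+\mu)R(x)+\mu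 R^*(y)-\mu\langle x,y\rangle$$ on $\mathbb{E}\times\mathbb{E}$ is a KL function. That is, $\sigma=F_{\beta,\mu}$ is proper and lsc and, with $\partial\sigma$ the limiting subdifferential, for every $s^*$ with $\partial\sigma(s^*)\ne\emptyset$ there are $\eta\in(0,+\infty]$, a neighborhood $U$ of $s^*$ and a continuous concave $\varphi:[0,\eta)\to[0,\infty)$ with $\varphi(0)=0$, $\varphi\in C^1(0,\eta)$ and $\varphi'>0$ on $(0,\eta)$, such that $\varphi'(\sigma(s)-\sigma(s^*))\,\operatorname{dist}(0,\partial\sigma(s))\ge1$ for all $s\in U$ with $\sigma(s^*)<\sigma(s)<\sigma(s^*)+\eta$ (where $\operatorname{dist}(0,\emptyset)=+\infty$). Let $x^0\in\operatorname{int}\operatorname{dom}h$ and $p^0\in\partial R(x^0)$, and let $(x^k,p^k)$ be generated by $$x^{k+1}=\arg\min_x\Big\{\langle\nabla E(x^k),x-x^k\rangle+\beta R(x)+\tfrac1{\delta^k}D_h(x,x^k)+\mu^kD_R^{p^k}(x,x^k)\Big\},$$ $$p^{k+1}=\frac{\mu^k}{\mu^k+\beta}\,p^k-\frac1{\delta^k(\mu^k+\beta)}\big[\nabla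 h(x^{k+1})-\nabla h(x^k)+\delta^k\nabla E(x^k)\big],$$ where, for some $\omega\in(0,1+\alpha(h))$ and some $\tau>0$, for all $k\ge0$, $$0<\delta^k<\frac{1+\alpha(h)-\omega}{L},\qquad \tau<\delta^{k+1}\mu^{k+1}\le\delta^k\mu^k,\qquad \mu^k\ge\mu,$$ and $\sum_{k=0}^\infty(\mu^k-\mu)<\infty$. Assume that the level set $\{x:f_\beta(x)\le f_\beta(x^0)\}$ is bounded. Then $\sum_{k=0}^\infty\|x^{k+1}-x^k\|<\infty$, and $x^k$ converges to a point $x^*\in\operatorname{int}\operatorname{dom}h$ (so that $E$ is differentiable at $x^*$). If $\beta=0$, then $\nabla E(x^*)=0$. If $R^*$ is locally strongly convex (each point of $\operatorname{dom}R^*$ has a ball around it on whose intersection with $\operatorname{dom}R^*$ the function $R^*$ is strongly convex, with a modulus that may depend on the point), then $p^k$ also converges and $0\in\nabla E(x^*)+\beta\,\partial R(x^*)$. -/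

import Mathlib

open Filter Topology
open scoped Gradient InnerProductSpace

noncomputable section

namespace LBreIF

/-! Functions with values in `(-∞, +∞]` are modelled as `EReal`-valued functions; properness
(see `IsProper`) excludes the value `-∞`. -/

/-- The effective domain `dom f = {x | f x < +∞}`. -/
def dom {X : Type*} (f : X → EReal) : Set X := {x | f x < ⊤}

/-- The real-valued representative of `f`; it agrees with `f` wherever `f` is finite. -/
def realPart {X : Type*} (f : X → EReal) : X → ℝ := fun x => (f x).toReal

/-- `f` is proper: it never takes the value `-∞` and it is not identically `+∞`. -/
def IsProper {X : Type*} (f : X → EReal) : Prop := (∀ x, f x ≠ ⊥) ∧ ∃ x, f x ≠ ⊤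

/-- Proper, lower semicontinuous and convex. -/
structure IsProperLscConvex {X : Type*} [NormedAddCommGroup X] [InnerProductSpace ℝ X]
    (f : X → EReal) : Prop where
  proper : IsProper f
  lsc : LowerSemicontinuous f
  convex : ConvexOn ℝ (dom f) (realPart f)

/-- The gradient of (the real-valued representative of) `f`. -/
def grad {X : Type*} [NormedAddCommGroup X] [InnerProductSpace ℝ X] [FiniteDimensional ℝ X]
    (f : X → EReal) (x : X) : X := ∇ (realPart f) x

/-- The subdifferential of convex analysis. -/
def subdiff {X : Type*} [NormedAddCommGroup X] [InnerProductSpace ℝ X]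
    (f : X → EReal) (x : X) : Set X :=
  {v | x ∈ dom f ∧ ∀ z, f x + ((⟪v, z - x⟫_ℝ : ℝ) : EReal) ≤ f z}

/-- `dom ∂f`, the set of points at which the subdifferential is nonempty. -/
def domSubdiff {X : Type*} [NormedAddCommGroup X] [InnerProductSpace ℝ X]
    (f : X → EReal) : Set X := {x | (subdiff f x).Nonempty}

/-- The Fenchel conjugate `f* y = sup_x (⟨x, y⟩ - f x)`. -/
def conj {X : Type*} [NormedAddCommGroup X] [InnerProductSpace ℝ X]
    (f : X → EReal) (y : X) : EReal := ⨆ x, (((⟪x, y⟫_ℝ : ℝ) : EReal) - f x)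

/-- The generalized Bregman distance
`D_f^v(x, y) = f x - f y - ⟨v, x - y⟩`, for a subgradient `v` of `f` at `y`. -/
def genBregman {X : Type*} [NormedAddCommGroup X] [InnerProductSpace ℝ X]
    (f : X → EReal) (v x y : X) : EReal := f x - f y - ((⟪v, x - y⟫_ℝ : ℝ) : EReal)

/-- The Bregman distance `D_h(x, y) = h x - h y - ⟨∇h y, x - y⟩`. -/
def bregman {X : Type*} [NormedAddCommGroup X] [InnerProductSpace ℝ X] [FiniteDimensional ℝ X]
    (h : X → EReal) (x y : X) : EReal := genBregman h (grad h y) x y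

/-- Functions of Legendre type: proper lsc convex, essentially smooth, and strictly convex on the
interior of the domain. -/
structure IsLegendre {X : Type*} [NormedAddCommGroup X] [InnerProductSpace ℝ X]
    [FiniteDimensional ℝ X] (h : X → EReal) : Prop where
  properLscConvex : IsProperLscConvex h
  interior_nonempty : (interior (dom h)).Nonempty
  differentiable : ∀ x ∈ interior (dom h), DifferentiableAt ℝ (realPart h) x
  steep : ∀ (u : ℕ → X) (z : X), (∀ k, u k ∈ interior (dom h)) → z ∈ frontier (dom h) →
    Tendsto u atTop (𝓝 z) → Tendsto (fun k => ‖grad h (u k)‖) atTop atTop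
  strictConvex : StrictConvexOn ℝ (interior (dom h)) (realPart h)

/-- The symmetry coefficient
`α(h) = inf {D_h(x, y) / D_h(y, x) : x, y ∈ int dom h, x ≠ y}`. -/
def symmCoeff {X : Type*} [NormedAddCommGroup X] [InnerProductSpace ℝ X] [FiniteDimensional ℝ X]
    (h : X → EReal) : ℝ :=
  sInf {r | ∃ x ∈ interior (dom h), ∃ y ∈ interior (dom h), x ≠ y ∧
    r = (bregman h x y).toReal / (bregman h y x).toReal}

/-- `f` is strongly convex on its domain. -/
def IsStronglyConvex {X : Type*} [NormedAddCommGroup X] [InnerProductSpace ℝ X]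
    (f : X → EReal) : Prop := ∃ c > 0, StrongConvexOn (dom f) c (realPart f)

/-- `f` is locally strongly convex: near each point of its domain it is strongly convex, with a
modulus that may depend on the point. -/
def IsLocallyStronglyConvex {X : Type*} [NormedAddCommGroup X] [InnerProductSpace ℝ X]
    (f : X → EReal) : Prop :=
  ∀ x ∈ dom f, ∃ r > 0, ∃ c > 0, StrongConvexOn (Metric.ball x r ∩ dom f) c (realPart f)

/-- `f` is differentiable on `int dom f` and its gradient is Lipschitz on each bounded subset of
`int dom f`. -/
def IsLocallyGradLipschitz {X : Type*} [NormedAddCommGroup X] [InnerProductSpace ℝ X]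
    [FiniteDimensional ℝ X] (f : X → EReal) : Prop :=
  (∀ x ∈ interior (dom f), DifferentiableAt ℝ (realPart f) x) ∧
  ∀ U : Set X, Bornology.IsBounded U → U ⊆ interior (dom f) →
    ∃ C > 0, ∀ x ∈ U, ∀ y ∈ U, ‖grad f x - grad f y‖ ≤ C * ‖x - y‖

/-- The subgradients of `R` are uniformly bounded on each bounded set. -/
def HasLocallyBoundedSubgradients {X : Type*} [NormedAddCommGroup X] [InnerProductSpace ℝ X]
    (R : X → EReal) : Prop :=
  ∀ U : Set X, Bornology.IsBounded U → ∃ C > 0, ∀ x ∈ U, ∀ p ∈ subdiff R x, ‖p‖ ≤ C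

/-- If `u k ∈ int dom h` converges to `z ∈ dom h`, then `D_h(z, u k) → 0` and
`D_R(z, u k) → 0`, whichever subgradients of `R` at the points `u k` are used. -/
def BregmanVanish {X : Type*} [NormedAddCommGroup X] [InnerProductSpace ℝ X]
    [FiniteDimensional ℝ X] (h R : X → EReal) : Prop :=
  ∀ (u : ℕ → X) (z : X), (∀ k, u k ∈ interior (dom h)) → z ∈ dom h →
    Tendsto u atTop (𝓝 z) →
      Tendsto (fun k => bregman h z (u k)) atTop (𝓝 0) ∧
      ∀ q : ℕ → X, (∀ k, q k ∈ subdiff R (u k)) →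
        Tendsto (fun k => genBregman R (q k) z (u k)) atTop (𝓝 0)

/-- The objective `f_β = β R + E`. -/
def objective {X : Type*} (E R : X → EReal) (β : ℝ) (x : X) : EReal := (β : EReal) * R x + E x

/-- The standing assumptions on `h`, `R`, `E`, on the parameter `β ≥ 0` and on the constant `L`
of the Lipschitz-like convexity condition. -/
structure BasicAssumption {X : Type*} [NormedAddCommGroup X] [InnerProductSpace ℝ X]
    [FiniteDimensional ℝ X] (h R E : X → EReal) (β L : ℝ) : Prop where
  legendre : IsLegendre h
  R_nonneg : ∀ x, 0 ≤ R x
  R_properLscConvex : IsProperLscConvex R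
  R_domSubdiff : interior (dom h) ⊆ domSubdiff R
  R_dom : (dom R ∩ interior (dom h)).Nonempty
  E_proper : IsProper E
  E_lsc : LowerSemicontinuous E
  E_dom : dom h ⊆ dom E
  E_differentiable : ∀ x ∈ interior (dom h), DifferentiableAt ℝ (realPart E) x
  E_continuousOn : ContinuousOn E (dom h)
  L_pos : 0 < L
  lipschitzLike : ConvexOn ℝ (interior (dom h)) (fun x => L * realPart h x - realPart E x)
  β_nonneg : 0 ≤ β
  bddBelow : ⊥ < ⨅ x ∈ dom h, objective E R β x

/-- The objective of the subproblem solved at an iterate `xk` with subgradient `pk`, step size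
`d` and parameter `m`:
`⟨∇E xk, x - xk⟩ + β R x + (1/d) D_h(x, xk) + m D_R^pk(x, xk)`. -/
def subproblem {X : Type*} [NormedAddCommGroup X] [InnerProductSpace ℝ X]
    [FiniteDimensional ℝ X] (h R E : X → EReal) (β d m : ℝ) (xk pk x : X) : EReal :=
  ((⟪grad E xk, x - xk⟫_ℝ : ℝ) : EReal) + (β : EReal) * R x
    + ((1 / d : ℝ) : EReal) * bregman h x xk + (m : EReal) * genBregman R pk x xk

/-- `(x k, p k)` is generated by the linearized Bregman iteration framework with step sizes
`δ k` and parameters `m k`. -/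
structure IsIteration {X : Type*} [NormedAddCommGroup X] [InnerProductSpace ℝ X]
    [FiniteDimensional ℝ X] (h R E : X → EReal) (β : ℝ) (δ m : ℕ → ℝ) (x p : ℕ → X) : Prop where
  x_zero : x 0 ∈ interior (dom h)
  p_zero : p 0 ∈ subdiff R (x 0)
  x_succ : ∀ k z, subproblem h R E β (δ k) (m k) (x k) (p k) (x (k + 1)) ≤
    subproblem h R E β (δ k) (m k) (x k) (p k) z
  p_succ : ∀ k, p (k + 1) = (m k / (m k + β)) • p k
    - (1 / (δ k * (m k + β))) • (grad h (x (k + 1)) - grad h (x k) + δ k • grad E (x k))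

/-- The surrogate `F(x, y) = E x + (β + μ) R x + μ R* y - μ ⟨x, y⟩` on the Euclidean product. -/
def surrogate {X : Type*} [NormedAddCommGroup X] [InnerProductSpace ℝ X]
    (E R : X → EReal) (β μ : ℝ) (s : WithLp 2 (X × X)) : EReal :=
  E s.fst + ((β + μ : ℝ) : EReal) * R s.fst + (μ : EReal) * conj R s.snd
    - ((μ * ⟪s.fst, s.snd⟫_ℝ : ℝ) : EReal)

/-- The Fréchet (regular) subdifferential. -/
def frechetSubdiff {Y : Type*} [NormedAddCommGroup Y] [InnerProductSpace ℝ Y]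
    (σ : Y → EReal) (x : Y) : Set Y :=
  {v | σ x ≠ ⊥ ∧ σ x ≠ ⊤ ∧ ∀ ε > 0, ∀ᶠ y in 𝓝 x,
    σ x + ((⟪v, y - x⟫_ℝ - ε * ‖y - x‖ : ℝ) : EReal) ≤ σ y}

/-- The limiting (Mordukhovich) subdifferential of a possibly nonconvex function. -/
def limitingSubdiff {Y : Type*} [NormedAddCommGroup Y] [InnerProductSpace ℝ Y]
    (σ : Y → EReal) (x : Y) : Set Y :=
  {v | σ x ≠ ⊥ ∧ σ x ≠ ⊤ ∧ ∃ (u w : ℕ → Y), Tendsto u atTop (𝓝 x) ∧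
    Tendsto (fun k => σ (u k)) atTop (𝓝 (σ x)) ∧
    (∀ k, w k ∈ frechetSubdiff σ (u k)) ∧ Tendsto w atTop (𝓝 v)}

/-- The Kurdyka-Łojasiewicz property of `σ` at `xs`. The distance from `0` to an empty
subdifferential is `+∞`. -/
def HasKLProperty {Y : Type*} [NormedAddCommGroup Y] [InnerProductSpace ℝ Y]
    (σ : Y → EReal) (xs : Y) : Prop :=
  ∃ (η : EReal) (U : Set Y) (φ : ℝ → ℝ), 0 < η ∧ U ∈ 𝓝 xs ∧
    ContinuousOn φ {t : ℝ | 0 ≤ t ∧ (t : EReal) < η} ∧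
    ConcaveOn ℝ {t : ℝ | 0 ≤ t ∧ (t : EReal) < η} φ ∧
    (∀ t : ℝ, 0 ≤ t → (t : EReal) < η → 0 ≤ φ t) ∧
    φ 0 = 0 ∧
    ContDiffOn ℝ 1 φ {t : ℝ | 0 < t ∧ (t : EReal) < η} ∧
    (∀ t : ℝ, 0 < t → (t : EReal) < η → 0 < deriv φ t) ∧
    ∀ z ∈ U, σ xs < σ z → σ z < σ xs + η →
      1 ≤ ENNReal.ofReal (deriv φ ((σ z).toReal - (σ xs).toReal)) *
        Metric.infEDist 0 (limitingSubdiff σ z)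

/-- KL functions: proper lsc functions that have the KL property at each point of `dom ∂σ`. -/
structure IsKLFunction {Y : Type*} [NormedAddCommGroup Y] [InnerProductSpace ℝ Y]
    (σ : Y → EReal) : Prop where
  proper : IsProper σ
  lsc : LowerSemicontinuous σ
  kl : ∀ xs, (limitingSubdiff σ xs).Nonempty → HasKLProperty σ xs

end LBreIF

end

/-!
The gradient of `h` blows up at the boundary of `dom h` but is Lipschitz on bounded sets, so `h`,
and with it `R` and `E`, is finite everywhere. Along the iteration, Young's equality turns the
surrogate into `F(x^{k+1}, p^k) = f_β(x^{k+1}) + μ D_R(x^{k+1}, x^k)`. These values decrease by at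
least a multiple of `‖x^{k+2} - x^{k+1}‖²`, and the subdifferential of `F` at `(x^{k+1}, p^k)`
contains an element of norm `O(‖x^{k+1} - x^k‖)` up to a multiple of the summable error `m k - μ`.
The Kurdyka-Łojasiewicz inequality then makes the path `x` finite in length.

In the limit the update rule becomes `(β + μ) p^{k+1} - μ p^k → -∇E(x*)`. For `β > 0` this recursion
is a contraction, which forces `p` to converge to `-∇E(x*) / β`. For `β = 0` the increments of the
bounded sequence `p` converge, necessarily to `0`, so `∇E(x*) = 0`.
-/

namespace LBreIF

section RealValued

variable {X : Type*}

/-- A finite-valued function, regarded as a function with values in `(-∞, +∞]`. -/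
noncomputable def ofReal (f : X → ℝ) : X → EReal := fun x => f x

@[simp]
theorem dom_ofReal (f : X → ℝ) : dom (ofReal f) = Set.univ :=
  Set.eq_univ_of_forall fun x => EReal.coe_lt_top (f x)

@[simp]
theorem realPart_ofReal (f : X → ℝ) : realPart (ofReal f) = f :=
  funext fun x => EReal.toReal_coe (f x)

theorem ofReal_realPart {f : X → EReal} (hbot : ∀ x, f x ≠ ⊥) (hdom : dom f = Set.univ) :
    ofReal (realPart f) = f :=
  funext fun x => EReal.coe_toReal (Set.eq_univ_iff_forall.1 hdom x).ne (hbot x)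

@[simp]
theorem objective_ofReal (e r : X → ℝ) (β : ℝ) (z : X) :
    objective (ofReal e) (ofReal r) β z = ((β * r z + e z : ℝ) : EReal) := by
  simp only [objective, ofReal, EReal.coe_add, EReal.coe_mul]

variable [NormedAddCommGroup X] [InnerProductSpace ℝ X]

/-- The generalized Bregman distance of a finite-valued function, with real values; `v` need not
be a subgradient. -/
noncomputable def realBregman (f : X → ℝ) (v x y : X) : ℝ := f x - f y - ⟪v, x - y⟫_ℝ

@[simp]
theorem realBregman_self (f : X → ℝ) (v x : X) : realBregman f v x x = 0 := by
  simp [realBregman]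

theorem genBregman_ofReal (f : X → ℝ) (v x y : X) :
    genBregman (ofReal f) v x y = realBregman f v x y := by
  simp only [genBregman, ofReal, realBregman, EReal.coe_sub]

theorem mem_subdiff_ofReal {f : X → ℝ} {v y : X} :
    v ∈ subdiff (ofReal f) y ↔ ∀ z, 0 ≤ realBregman f v z y := by
  simp only [subdiff, dom_ofReal, Set.mem_univ, true_and, Set.mem_ofPred_eq, ofReal, realBregman,
    ← EReal.coe_add, EReal.coe_le_coe_iff, sub_sub, sub_nonneg]

variable [FiniteDimensional ℝ X]

@[simp]
theorem grad_ofReal (f : X → ℝ) (x : X) : grad (ofReal f) x = ∇ f x := by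
  rw [grad, realPart_ofReal]

theorem bregman_ofReal (H : X → ℝ) (x y : X) :
    bregman (ofReal H) x y = realBregman H (∇ H y) x y := by
  rw [bregman, genBregman_ofReal, grad_ofReal]

theorem subproblem_ofReal (H r e : X → ℝ) (β d m : ℝ) (x p z : X) :
    subproblem (ofReal H) (ofReal r) (ofReal e) β d m x p z =
      ((⟪∇ e x, z - x⟫_ℝ + β * r z + 1 / d * realBregman H (∇ H x) z x
        + m * realBregman r p z x : ℝ) : EReal) := by
  simp only [subproblem, bregman_ofReal, genBregman_ofReal, grad_ofReal, ofReal, EReal.coe_add,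
    EReal.coe_mul]

end RealValued

section Convex

variable {X : Type*} [NormedAddCommGroup X] [InnerProductSpace ℝ X] [CompleteSpace X]
  {s : Set X} {f : X → ℝ} {g x y : X}

-- Along the segment from `y` to `x`, bound the convex summand by its chord and differentiate.
theorem realBregman_neg_gradient_nonneg {S : X → ℝ} (hf : ConvexOn ℝ s f)
    (hS : HasGradientAt S g y) (hmin : IsMinOn (f + S) s y) (hy : y ∈ s) (hx : x ∈ s) :
    0 ≤ realBregman f (-g) x y := by
  have hline : HasDerivAt (fun t : ℝ => S (y + t • (x - y))) ⟪g, x - y⟫_ℝ 0 := by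
    simpa [HasLineDerivAt] using hS.hasFDerivAt.hasLineDerivAt (x - y)
  have hψ : HasDerivAt (fun t : ℝ => t * (f x - f y) + S (y + t • (x - y)))
      (f x - f y + ⟪g, x - y⟫_ℝ) 0 := by
    exact (((hasDerivAt_id (0 : ℝ)).mul_const (f x - f y)).add hline).congr_deriv (by simp)
  have hnonneg : 0 ≤ f x - f y + ⟪g, x - y⟫_ℝ := by
    refine ge_of_tendsto hψ.tendsto_slope_zero_right ?_
    filter_upwards [Ioc_mem_nhdsGT (zero_lt_one' ℝ)] with t ⟨ht, ht1⟩
    have hchord : f (y + t • (x - y)) ≤ (1 - t) * f y + t * f x := by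
      simpa [show (1 - t) • y + t • x = y + t • (x - y) by module] using
        hf.2 hy hx (sub_nonneg.2 ht1) ht.le (by ring)
    have hle : f y + S y ≤ f (y + t • (x - y)) + S (y + t • (x - y)) :=
      hmin (hf.1.add_smul_sub_mem hy hx ⟨ht.le, ht1⟩)
    simp only [zero_add, smul_eq_mul, zero_mul, zero_smul, add_zero]
    exact mul_nonneg (inv_nonneg.2 ht.le) (by linarith)
  simpa [realBregman] using hnonneg

theorem realBregman_gradient_nonneg (hf : ConvexOn ℝ s f) (hg : HasGradientAt f g y) (hy : y ∈ s)
    (hx : x ∈ s) : 0 ≤ realBregman f g x y := by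
  have hneg : HasGradientAt (-f) (-g) y := by
    simpa only [hasGradientAt_iff_hasFDerivAt, map_neg] using hg.hasFDerivAt.neg
  have hmin : IsMinOn (f + -f) s y := fun z _ => by simp
  simpa using realBregman_neg_gradient_nonneg hf hneg hmin hy hx

theorem mul_sq_norm_sub_le_realBregman {c : ℝ} (hf : StrongConvexOn s c f)
    (hg : HasGradientAt f g y) (hy : y ∈ s) (hx : x ∈ s) :
    c / 2 * ‖x - y‖ ^ 2 ≤ realBregman f g x y := by
  have hquad : HasGradientAt (fun z => f z - c / 2 * ‖z‖ ^ 2) (g - c • y) y := by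
    rw [hasGradientAt_iff_hasFDerivAt]
    refine (hg.hasFDerivAt.sub
      ((hasStrictFDerivAt_norm_sq y).hasFDerivAt.const_mul (c / 2))).congr_fderiv ?_
    ext z
    simp only [map_sub, map_smul, sub_apply, smul_apply,
      InnerProductSpace.toDual_apply_apply, innerSL_apply_apply, smul_eq_mul, nsmul_eq_mul]
    ring
  have hnonneg := realBregman_gradient_nonneg (strongConvexOn_iff_convex.1 hf) hquad hy hx
  have hid : realBregman (fun z => f z - c / 2 * ‖z‖ ^ 2) (g - c • y) x y =
      realBregman f g x y - c / 2 * ‖x - y‖ ^ 2 := by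
    simp only [realBregman, norm_sub_sq_real, inner_sub_left, inner_sub_right,
      real_inner_smul_left, real_inner_self_eq_norm_sq, real_inner_comm y x]
    ring
  linarith

theorem realBregman_le_mul_realBregman {H e : X → ℝ} {L : ℝ} {gH ge : X}
    (hconv : ConvexOn ℝ s fun z => L * H z - e z) (hH : HasGradientAt H gH y)
    (he : HasGradientAt e ge y) (hy : y ∈ s) (hx : x ∈ s) :
    realBregman e ge x y ≤ L * realBregman H gH x y := by
  have hsub : HasGradientAt (fun z => L * H z - e z) (L • gH - ge) y := by
    rw [hasGradientAt_iff_hasFDerivAt, map_sub, map_smul]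
    exact (hH.hasFDerivAt.const_mul L).sub he.hasFDerivAt
  have hnonneg := realBregman_gradient_nonneg hconv hsub hy hx
  simp only [realBregman, inner_sub_left, real_inner_smul_left] at hnonneg ⊢
  linarith

end Convex

section Legendre

variable {X : Type*} [NormedAddCommGroup X] [InnerProductSpace ℝ X] [FiniteDimensional ℝ X]

theorem symmCoeff_mul_realBregman_le {H : X → ℝ} (hconv : ConvexOn ℝ Set.univ H)
    (hdiff : Differentiable ℝ H) (x y : X) :
    symmCoeff (ofReal H) * realBregman H (∇ H x) y x ≤ realBregman H (∇ H y) x y := by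
  have hnonneg : ∀ a b, 0 ≤ realBregman H (∇ H b) a b := fun a b =>
    realBregman_gradient_nonneg hconv (hdiff b).hasGradientAt (Set.mem_univ b) (Set.mem_univ a)
  rcases (hnonneg y x).eq_or_lt with hzero | hpos
  · simpa [← hzero] using hnonneg x y
  · have hne : x ≠ y := by
      rintro rfl
      simp at hpos
    rw [← le_div_iff₀ hpos]
    refine csInf_le ⟨0, ?_⟩ ⟨x, by simp, y, by simp, hne, by simp [bregman_ofReal]⟩
    rintro _ ⟨a, -, b, -, -, rfl⟩
    simpa [bregman_ofReal] using div_nonneg (hnonneg a b) (hnonneg b a)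

-- At a boundary point of the domain the gradient would blow up along a convergent, hence bounded,
-- sequence, which its Lipschitz continuity on bounded sets excludes.
theorem IsLegendre.dom_eq_univ {h : X → EReal} (hL : IsLegendre h)
    (hg : IsLocallyGradLipschitz h) : dom h = Set.univ := by
  by_contra hne
  obtain ⟨z, hz⟩ := nonempty_frontier_iff.2 ⟨hL.interior_nonempty.mono interior_subset, hne⟩
  have hcl : z ∈ closure (interior (dom h)) := by
    rw [hL.properLscConvex.convex.1.closure_interior_eq_closure_of_nonempty_interior
      hL.interior_nonempty]
    exact frontier_subset_closure hz
  obtain ⟨u, hu, hlim⟩ := mem_closure_iff_seq_limit.1 hcl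
  have hbdd := Metric.isBounded_range_of_tendsto u hlim
  obtain ⟨C, hC, hlip⟩ := hg.2 (Set.range u) hbdd (Set.range_subset_iff.2 hu)
  obtain ⟨D, hD⟩ := Metric.isBounded_iff.1 hbdd
  refine not_bddAbove_of_tendsto_atTop (hL.steep u z hu hz hlim)
    ⟨C * D + ‖grad h (u 0)‖, Set.forall_mem_range.2 fun k => ?_⟩
  have hdist : ‖u k - u 0‖ ≤ D :=
    dist_eq_norm (u k) (u 0) ▸ hD (Set.mem_range_self k) (Set.mem_range_self 0)
  calc ‖grad h (u k)‖ ≤ ‖grad h (u k) - grad h (u 0)‖ + ‖grad h (u 0)‖ :=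
        norm_le_norm_sub_add _ _
    _ ≤ C * ‖u k - u 0‖ + ‖grad h (u 0)‖ := by
        gcongr
        exact hlip _ (Set.mem_range_self k) _ (Set.mem_range_self 0)
    _ ≤ C * D + ‖grad h (u 0)‖ := by gcongr

end Legendre

section Conjugate

variable {X : Type*} [NormedAddCommGroup X] [InnerProductSpace ℝ X] {f : X → ℝ}

theorem le_conj_ofReal (f : X → ℝ) (x y : X) :
    ((⟪x, y⟫_ℝ - f x : ℝ) : EReal) ≤ conj (ofReal f) y := by
  rw [EReal.coe_sub]
  exact le_iSup (fun x => ((⟪x, y⟫_ℝ : ℝ) : EReal) - ofReal f x) x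

theorem conj_ofReal_eq_of_mem_subdiff {p x : X} (hp : p ∈ subdiff (ofReal f) x) :
    conj (ofReal f) p = ((⟪x, p⟫_ℝ - f x : ℝ) : EReal) := by
  refine le_antisymm (iSup_le fun z => ?_) (le_conj_ofReal f x p)
  rw [ofReal, ← EReal.coe_sub, EReal.coe_le_coe_iff, real_inner_comm, real_inner_comm p x]
  have := mem_subdiff_ofReal.1 hp z
  rw [realBregman, inner_sub_right] at this
  linarith

theorem convex_subdiff_ofReal (f : X → ℝ) (x : X) : Convex ℝ (subdiff (ofReal f) x) := by
  intro p hp q hq a b ha hb hab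
  rw [mem_subdiff_ofReal] at hp hq ⊢
  intro z
  have hcomb : realBregman f (a • p + b • q) z x =
      a * realBregman f p z x + b * realBregman f q z x := by
    simp only [realBregman, inner_add_left, real_inner_smul_left]
    linear_combination (f x - f z) * hab
  rw [hcomb]
  exact add_nonneg (mul_nonneg ha (hp z)) (mul_nonneg hb (hq z))

theorem mem_subdiff_ofReal_of_tendsto (hf : Continuous f) {u q : ℕ → X} {y v : X}
    (hu : Tendsto u atTop (𝓝 y)) (hq : Tendsto q atTop (𝓝 v))
    (hmem : ∀ k, q k ∈ subdiff (ofReal f) (u k)) : v ∈ subdiff (ofReal f) y :=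
  mem_subdiff_ofReal.2 fun z => ge_of_tendsto
    ((((hf.tendsto y).comp hu).const_sub (f z)).sub (hq.inner (hu.const_sub z)))
    (Eventually.of_forall fun k => mem_subdiff_ofReal.1 (hmem k) z)

-- On `∂f(x)` the conjugate is affine, so strict convexity leaves room for a single point.
theorem subdiff_ofReal_subsingleton (hc : IsLocallyStronglyConvex (conj (ofReal f))) (x : X) :
    (subdiff (ofReal f) x).Subsingleton := by
  intro p hp q hq
  by_contra hne
  have hdom : subdiff (ofReal f) x ⊆ dom (conj (ofReal f)) := fun v hv =>
    (conj_ofReal_eq_of_mem_subdiff hv).trans_lt (EReal.coe_lt_top _)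
  have hval : ∀ v ∈ subdiff (ofReal f) x, realPart (conj (ofReal f)) v = ⟪x, v⟫_ℝ - f x :=
    fun v hv => by rw [realPart, conj_ofReal_eq_of_mem_subdiff hv, EReal.toReal_coe]
  obtain ⟨ρ, hρ, c, hc0, hsc⟩ := hc p (hdom hp)
  have hnear : ∀ᶠ t : ℝ in 𝓝[>] 0, AffineMap.lineMap p q t ∈ Metric.ball p ρ :=
    (AffineMap.lineMap_continuous.tendsto' 0 p (AffineMap.lineMap_apply_zero p q)).mono_left
      nhdsWithin_le_nhds (Metric.ball_mem_nhds p hρ)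
  obtain ⟨t, htball, ht0, ht1⟩ := (hnear.and (Ioc_mem_nhdsGT (zero_lt_one' ℝ))).exists
  set q' := AffineMap.lineMap p q t
  have hq' : q' ∈ subdiff (ofReal f) x :=
    (convex_subdiff_ofReal f x).lineMap_mem hp hq ⟨ht0.le, ht1⟩
  have hne' : p ≠ q' := fun heq =>
    (AffineMap.lineMap_eq_left_iff.1 heq.symm).elim hne ht0.ne'
  have hlt := (hsc.strictConvexOn hc0).2 ⟨Metric.mem_ball_self hρ, hdom hp⟩ ⟨htball, hdom hq'⟩
    hne' one_half_pos one_half_pos (add_halves 1)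
  rw [hval p hp, hval q' hq', hval _ (convex_subdiff_ofReal f x hp hq' one_half_pos.le
    one_half_pos.le (add_halves 1)), inner_add_right, real_inner_smul_right,
    real_inner_smul_right, smul_eq_mul, smul_eq_mul] at hlt
  linarith

end Conjugate

section Desingularizing

/-- Desingularizing functions of the KL inequality on `[0, η)`. Only differences of values
of `φ` matter, so `φ` is not normalized by `φ 0 = 0`. -/
structure IsDesingularizing (η : ℝ) (φ : ℝ → ℝ) : Prop where
  pos : 0 < η
  concaveOn : ConcaveOn ℝ (Set.Ico 0 η) φ
  nonneg : ∀ t ∈ Set.Ico 0 η, 0 ≤ φ t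
  deriv_pos : ∀ t ∈ Set.Ioo 0 η, 0 < deriv φ t

namespace IsDesingularizing

variable {η θ : ℝ} {φ ψ : ℝ → ℝ}

theorem id : IsDesingularizing 1 id where
  pos := one_pos
  concaveOn := concaveOn_id (convex_Ico 0 1)
  nonneg _ ht := ht.1
  deriv_pos t _ := by simp

theorem differentiableAt (hφ : IsDesingularizing η φ) {t : ℝ} (ht : t ∈ Set.Ioo 0 η) :
    DifferentiableAt ℝ φ t :=
  differentiableAt_of_deriv_ne_zero (hφ.deriv_pos t ht).ne'

theorem mono (hφ : IsDesingularizing η φ) (hθ : 0 < θ) (hle : θ ≤ η) : IsDesingularizing θ φ where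
  pos := hθ
  concaveOn := hφ.concaveOn.subset (Set.Ico_subset_Ico_right hle) (convex_Ico 0 θ)
  nonneg t ht := hφ.nonneg t (Set.Ico_subset_Ico_right hle ht)
  deriv_pos t ht := hφ.deriv_pos t (Set.Ioo_subset_Ioo_right hle ht)

theorem add (hφ : IsDesingularizing η φ) (hψ : IsDesingularizing η ψ) :
    IsDesingularizing η (φ + ψ) where
  pos := hφ.pos
  concaveOn := hφ.concaveOn.add hψ.concaveOn
  nonneg t ht := add_nonneg (hφ.nonneg t ht) (hψ.nonneg t ht)
  deriv_pos t ht := by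
    rw [deriv_add (hφ.differentiableAt ht) (hψ.differentiableAt ht)]
    exact add_pos (hφ.deriv_pos t ht) (hψ.deriv_pos t ht)

theorem deriv_mul_sub_le (hφ : IsDesingularizing η φ) {t u : ℝ} (ht : t ∈ Set.Ioo 0 η)
    (hu : 0 ≤ u) (hut : u ≤ t) : deriv φ t * (t - u) ≤ φ t - φ u := by
  rcases hut.eq_or_lt with rfl | hlt
  · simp
  · have hslope := hφ.concaveOn.le_slope_of_hasDerivAt ⟨hu, hlt.trans ht.2⟩
      (Set.Ioo_subset_Ico_self ht) hlt (hφ.differentiableAt ht).hasDerivAt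
    rwa [slope_def_field, le_div_iff₀ (sub_pos.2 hlt)] at hslope

end IsDesingularizing

end Desingularizing

section KL

variable {Y : Type*} [NormedAddCommGroup Y] [InnerProductSpace ℝ Y] {σ : Y → EReal}

/-- The KL inequality `φ'(σ z - c) * dist (0, ∂σ z) ≥ 1` at a point `z` with `c < σ z < c + η`, the
distance being written out over the limiting subgradients. -/
def KLInequality (σ : Y → EReal) (c η : ℝ) (φ : ℝ → ℝ) (z : Y) : Prop :=
  ∀ v : ℝ, σ z = v → v ∈ Set.Ioo c (c + η) → ∀ w ∈ limitingSubdiff σ z, 1 ≤ deriv φ (v - c) * ‖w‖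

namespace KLInequality

variable {c η θ : ℝ} {φ ψ : ℝ → ℝ} {z : Y}

theorem mono (h : KLInequality σ c η φ z) (hle : θ ≤ η) : KLInequality σ c θ φ z :=
  fun v hv hmem => h v hv ⟨hmem.1, hmem.2.trans_le (by gcongr)⟩

theorem add_right (h : KLInequality σ c η φ z) (hφ : IsDesingularizing η φ)
    (hψ : IsDesingularizing η ψ) : KLInequality σ c η (φ + ψ) z := by
  intro v hv hmem w hw
  have ht : v - c ∈ Set.Ioo 0 η := ⟨sub_pos.2 hmem.1, sub_lt_iff_lt_add'.2 hmem.2⟩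
  calc 1 ≤ deriv φ (v - c) * ‖w‖ := h v hv hmem w hw
    _ ≤ deriv (φ + ψ) (v - c) * ‖w‖ := by
      rw [deriv_add (hφ.differentiableAt ht) (hψ.differentiableAt ht)]
      gcongr
      exact le_add_of_nonneg_right (hψ.deriv_pos _ ht).le

end KLInequality

theorem HasKLProperty.exists_klInequality {z : Y} {c : ℝ} (h : HasKLProperty σ z)
    (hc : σ z = c) :
    ∃ η φ, IsDesingularizing η φ ∧ ∀ᶠ y in 𝓝 z, KLInequality σ c η φ y := by
  obtain ⟨ζ, U, φ, hζ, hU, -, hconc, hnn, -, -, hpos, hkl⟩ := h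
  obtain ⟨η, hη0, hηζ⟩ := EReal.lt_iff_exists_real_btwn.1 hζ
  have hlt : ∀ t : ℝ, t < η → (t : EReal) < ζ := fun t ht =>
    (EReal.coe_lt_coe_iff.2 ht).trans hηζ
  have hφ : IsDesingularizing η φ :=
    { pos := EReal.coe_lt_coe_iff.1 hη0
      concaveOn := hconc.subset (fun t ht => ⟨ht.1, hlt t ht.2⟩) (convex_Ico 0 η)
      nonneg := fun t ht => hnn t ht.1 (hlt t ht.2)
      deriv_pos := fun t ht => hpos t ht.1 (hlt t ht.2) }
  refine ⟨η, φ, hφ, Filter.mem_of_superset hU fun y hy v hv hmem w hw => ?_⟩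
  have hupper : σ y < σ z + ζ := by
    rw [hv, hc]
    exact (EReal.coe_lt_coe_iff.2 hmem.2).trans_le (by rw [EReal.coe_add]; gcongr)
  have hdist := hkl y hy (by rw [hv, hc]; exact EReal.coe_lt_coe_iff.2 hmem.1) hupper
  rw [hv, hc, EReal.toReal_coe, EReal.toReal_coe] at hdist
  have hderiv : 0 ≤ deriv φ (v - c) :=
    (hφ.deriv_pos _ ⟨sub_pos.2 hmem.1, sub_lt_iff_lt_add'.2 hmem.2⟩).le
  refine ENNReal.one_le_ofReal.1 (hdist.trans ?_)
  rw [ENNReal.ofReal_mul hderiv, ofReal_norm, ← edist_zero_right, edist_comm]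
  gcongr
  exact Metric.infEDist_le_edist_of_mem hw

theorem exists_klInequality_nhdsSet {K : Set Y} {c : ℝ} (hK : IsCompact K)
    (h : ∀ z ∈ K, σ z = c ∧ HasKLProperty σ z) :
    ∃ η φ, IsDesingularizing η φ ∧ ∀ᶠ y in 𝓝ˢ K, KLInequality σ c η φ y := by
  refine hK.induction_on
    (p := fun S => ∃ η φ, IsDesingularizing η φ ∧ ∀ᶠ y in 𝓝ˢ S, KLInequality σ c η φ y)
    ⟨1, _, IsDesingularizing.id, by simp⟩ ?_ ?_ fun z hz => ?_
  · rintro S T hST ⟨η, φ, hφ, hT⟩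
    exact ⟨η, φ, hφ, hT.filter_mono (nhdsSet_mono hST)⟩
  · rintro S T ⟨η, φ, hφ, hS⟩ ⟨θ, ψ, hψ, hT⟩
    have hmin : 0 < min η θ := lt_min hφ.pos hψ.pos
    have hφ' := hφ.mono hmin (min_le_left η θ)
    have hψ' := hψ.mono hmin (min_le_right η θ)
    refine ⟨min η θ, φ + ψ, hφ'.add hψ', ?_⟩
    rw [nhdsSet_union, eventually_sup]
    exact ⟨hS.mono fun y hy => (hy.mono (min_le_left η θ)).add_right hφ' hψ',
      hT.mono fun y hy => add_comm ψ φ ▸ (hy.mono (min_le_right η θ)).add_right hψ' hφ'⟩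
  · obtain ⟨hc, hkl⟩ := h z hz
    obtain ⟨η, φ, hφ, hev⟩ := hkl.exists_klInequality hc
    obtain ⟨U, hU, hUo, hzU⟩ := eventually_nhds_iff.1 hev
    exact ⟨U, mem_nhdsWithin_of_mem_nhds (hUo.mem_nhds hzU), η, φ, hφ,
      Filter.mem_of_superset hUo.mem_nhdsSet_self hU⟩

theorem frechetSubdiff_subset_limitingSubdiff (σ : Y → EReal) (z : Y) :
    frechetSubdiff σ z ⊆ limitingSubdiff σ z := fun v hv =>
  ⟨hv.1, hv.2.1, fun _ => z, fun _ => v, tendsto_const_nhds, tendsto_const_nhds, fun _ => hv,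
    tendsto_const_nhds⟩

theorem mem_frechetSubdiff_of_hasFDerivAt {G : Y → ℝ} {v z : Y}
    (hG : HasFDerivAt G (innerSL ℝ v) z) (hle : ∀ y, (G y : EReal) ≤ σ y) (heq : σ z = G z) :
    v ∈ frechetSubdiff σ z := by
  refine ⟨by simp [heq], by simp [heq], fun ε hε => ?_⟩
  filter_upwards [hG.isLittleO.def hε] with y hy
  refine le_trans ?_ (hle y)
  rw [heq, ← EReal.coe_add, EReal.coe_le_coe_iff]
  rw [innerSL_apply_apply] at hy
  linarith [(abs_le.1 hy).1]

end KL

section ClusterPoints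

variable {Y : Type*} [TopologicalSpace Y] [T2Space Y] {K : Set Y} {s : ℕ → Y}

theorem isCompact_setOf_mapClusterPt (hK : IsCompact K) (hs : ∀ k, s k ∈ K) :
    IsCompact {z | MapClusterPt z atTop s} :=
  hK.of_isClosed_subset isClosed_setOfPred_clusterPt fun _ hz =>
    hK.isClosed.mem_of_mapClusterPt hz (Eventually.of_forall hs)

end ClusterPoints

section InexactDescent

theorem summable_of_eventually_two_mul_le {Δ ε ψ : ℕ → ℝ} (hΔ : ∀ k, 0 ≤ Δ k)
    (hε0 : ∀ k, 0 ≤ ε k) (hε : Summable ε) (hψ : ∀ᶠ k in atTop, 0 ≤ ψ k)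
    (hrec : ∀ᶠ k in atTop, 2 * Δ (k + 1) ≤ Δ k + ε k + (ψ k - ψ (k + 1))) : Summable Δ := by
  obtain ⟨N, hN⟩ := eventually_atTop.1 (hψ.and hrec)
  have hbound : ∀ n, ∑ k ∈ Finset.range n, Δ (k + N) + 2 * Δ (n + N) + ψ (n + N) ≤
      2 * Δ N + ψ N + ∑ k ∈ Finset.range n, ε (k + N) := by
    intro n
    induction n with
    | zero => simp
    | succ n ih =>
      have := (hN (n + N) (by omega)).2
      rw [Finset.sum_range_succ, Finset.sum_range_succ, show n + 1 + N = n + N + 1 by omega]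
      linarith
  rw [← summable_nat_add_iff N]
  refine summable_of_sum_range_le (c := 2 * Δ N + ψ N + ∑' k, ε (k + N)) (fun k => hΔ _)
    fun n => ?_
  have htail := ((summable_nat_add_iff N).2 hε).sum_le_tsum (Finset.range n) fun k _ => hε0 _
  linarith [hbound n, hΔ (n + N), (hN (n + N) (by omega)).1]

theorem two_mul_le_add_of_mul_sq_le {a b t u A D P W : ℝ} (ha : 0 < a) (hb : 0 < b) (hD : 0 < D)
    (hP : D * u ≤ P) (hu : a * t ^ 2 ≤ u) (hW : W ≤ b * A) (hDW : 1 ≤ D * W) :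
    2 * t ≤ A + b / a * P := by
  have hA : 0 ≤ A := by
    by_contra! hneg
    nlinarith [mul_pos hb (neg_pos.2 hneg)]
  have hu0 : 0 ≤ u := le_trans (by positivity) hu
  have hP0 : 0 ≤ P := le_trans (by positivity) hP
  have hsq : t ^ 2 ≤ A * (b / a * P) := by
    rw [show A * (b / a * P) = b * A * P / a by ring, le_div_iff₀' ha]
    calc a * t ^ 2 ≤ u * 1 := by rwa [mul_one]
      _ ≤ u * (D * W) := by gcongr
      _ = W * (D * u) := by ring
      _ ≤ b * A * P := by gcongr
  have hamgm : (2 * t) ^ 2 ≤ (A + b / a * P) ^ 2 := by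
    linarith [four_mul_le_sq_add A (b / a * P)]
  exact (abs_le_of_sq_le_sq' hamgm (by positivity)).2

variable {Y : Type*} [NormedAddCommGroup Y] [InnerProductSpace ℝ Y] {σ : Y → EReal}
  {s w : ℕ → Y} {v Δ ε : ℕ → ℝ} {a b c : ℝ}

/-- The Attouch–Bolte–Svaiter conditions on a descent sequence `s` of `σ`: the values `v` decrease
by at least the squares of the steps `Δ`, and there are subgradients `w` whose norms are
controlled by the steps, up to summable errors `ε`. -/
structure IsInexactDescent (σ : Y → EReal) (s w : ℕ → Y) (v Δ ε : ℕ → ℝ) (a b : ℝ) : Prop where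
  a_pos : 0 < a
  b_pos : 0 < b
  value : ∀ k, σ (s k) = v k
  mem_frechetSubdiff : ∀ k, w k ∈ frechetSubdiff σ (s k)
  step_nonneg : ∀ k, 0 ≤ Δ k
  error_nonneg : ∀ k, 0 ≤ ε k
  summable_error : Summable ε
  decrease : ∀ k, v (k + 1) + a * Δ (k + 1) ^ 2 ≤ v k
  norm_le : ∀ k, ‖w k‖ ≤ b * Δ k + ε k

namespace IsInexactDescent

theorem antitone (h : IsInexactDescent σ s w v Δ ε a b) : Antitone v :=
  antitone_nat_of_succ_le fun k =>
    (le_add_of_nonneg_right (mul_nonneg h.a_pos.le (sq_nonneg _))).trans (h.decrease k)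

theorem tendsto_step (h : IsInexactDescent σ s w v Δ ε a b) (hv : Tendsto v atTop (𝓝 c)) :
    Tendsto Δ atTop (𝓝 0) := by
  rw [← tendsto_add_atTop_iff_nat 1]
  have hsqrt : Tendsto (fun k => √((v k - v (k + 1)) / a)) atTop (𝓝 0) := by
    simpa using ((hv.sub (hv.comp (tendsto_add_atTop_nat 1))).div_const a).sqrt
  refine squeeze_zero (fun k => h.step_nonneg _) (fun k => Real.le_sqrt_of_sq_le ?_) hsqrt
  rw [le_div_iff₀' h.a_pos]
  linarith [h.decrease k]

theorem zero_mem_limitingSubdiff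
    (h : IsInexactDescent σ s w v Δ ε a b) (hv : Tendsto v atTop (𝓝 c)) {z : Y}
    (hz : MapClusterPt z atTop s) (hσz : σ z = c) : 0 ∈ limitingSubdiff σ z := by
  have hw : Tendsto w atTop (𝓝 0) := squeeze_zero_norm h.norm_le <| by
    simpa using ((h.tendsto_step hv).const_mul b).add h.summable_error.tendsto_atTop_zero
  obtain ⟨κ, hκ, hlim⟩ := hz.tendsto_subseq
  refine ⟨by simp [hσz], by simp [hσz], s ∘ κ, w ∘ κ, hlim, ?_, fun k => h.mem_frechetSubdiff _,
    hw.comp hκ.tendsto_atTop⟩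
  simp only [Function.comp_apply, h.value, hσz]
  exact (continuous_coe_real_ereal.tendsto c).comp (hv.comp hκ.tendsto_atTop)

theorem two_mul_step_le (h : IsInexactDescent σ s w v Δ ε a b) (hv : Tendsto v atTop (𝓝 c))
    {η : ℝ} {φ : ℝ → ℝ} (hφ : IsDesingularizing η φ) {k : ℕ} (hkl : KLInequality σ c η φ (s k))
    (hk : v k < c + η) :
    2 * Δ (k + 1) ≤ Δ k + ε k / b + (b / a * φ (v k - c) - b / a * φ (v (k + 1) - c)) := by
  have hsucc : v (k + 1) ≤ v k := h.antitone k.le_succ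
  have hc : ∀ j, c ≤ v j := h.antitone.le_of_tendsto hv
  have hrhs : 0 ≤ Δ k + ε k / b :=
    add_nonneg (h.step_nonneg k) (div_nonneg (h.error_nonneg k) h.b_pos.le)
  rcases (hc k).eq_or_lt with heq | hlt
  · have hconst : v (k + 1) = v k := le_antisymm hsucc (heq ▸ hc (k + 1))
    have hstep : Δ (k + 1) = 0 := by
      have hdec := h.decrease k
      rw [hconst, add_le_iff_nonpos_right] at hdec
      exact pow_eq_zero_iff two_ne_zero |>.1 <| le_antisymm
        (nonpos_of_mul_nonpos_right hdec h.a_pos) (sq_nonneg _)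
    simpa [hconst, hstep] using hrhs
  · have hmem : v k - c ∈ Set.Ioo 0 η := ⟨sub_pos.2 hlt, sub_lt_iff_lt_add'.2 hk⟩
    rw [← mul_sub]
    refine two_mul_le_add_of_mul_sq_le h.a_pos h.b_pos (hφ.deriv_pos _ hmem)
      (hφ.deriv_mul_sub_le hmem (sub_nonneg.2 (hc (k + 1))) (by gcongr)) ?_ ?_
      (hkl _ (h.value k) ⟨hlt, hk⟩ _
        (frechetSubdiff_subset_limitingSubdiff σ _ (h.mem_frechetSubdiff k)))
    · linarith [h.decrease k]
    · rw [mul_add, mul_div_cancel₀ _ h.b_pos.ne']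
      exact h.norm_le k

theorem summable_step (h : IsInexactDescent σ s w v Δ ε a b) (hv : Tendsto v atTop (𝓝 c))
    {K : Set Y} (hK : IsCompact K) (hs : ∀ k, s k ∈ K)
    (hσ : ∀ z, MapClusterPt z atTop s → σ z = c)
    (hkl : ∀ z, (limitingSubdiff σ z).Nonempty → HasKLProperty σ z) : Summable Δ := by
  obtain ⟨η, φ, hφ, hev⟩ := exists_klInequality_nhdsSet (isCompact_setOf_mapClusterPt hK hs)
    fun z hz => ⟨hσ z hz, hkl z ⟨0, h.zero_mem_limitingSubdiff hv hz (hσ z hz)⟩⟩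
  have hlim : Tendsto s atTop (𝓝ˢ {z | MapClusterPt z atTop s}) :=
    hK.tendsto_nhdsSet_of_mapClusterPt (Eventually.of_forall hs) fun z _ hz => hz
  have hlt : ∀ᶠ k in atTop, v k < c + η := hv.eventually_lt_const (lt_add_of_pos_right c hφ.pos)
  refine summable_of_eventually_two_mul_le (ε := fun k => ε k / b)
    (ψ := fun k => b / a * φ (v k - c)) h.step_nonneg
    (fun k => div_nonneg (h.error_nonneg k) h.b_pos.le) (h.summable_error.div_const b) ?_ ?_
  · filter_upwards [hlt] with k hk
    exact mul_nonneg (div_pos h.b_pos h.a_pos).le (hφ.nonneg _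
      ⟨sub_nonneg.2 (h.antitone.le_of_tendsto hv k), sub_lt_iff_lt_add'.2 hk⟩)
  · filter_upwards [hlt, hlim.eventually hev] with k hk hklk
    exact h.two_mul_step_le hv hφ hklk hk

end IsInexactDescent

end InexactDescent

section Surrogate

theorem norm_toLp_le {V W : Type*} [SeminormedAddCommGroup V] [SeminormedAddCommGroup W] (a : V)
    (b : W) : ‖WithLp.toLp 2 (a, b)‖ ≤ ‖a‖ + ‖b‖ := by
  rw [WithLp.prod_norm_eq_of_L2]
  exact Real.sqrt_le_iff.2
    ⟨by positivity, pow_add_pow_le (norm_nonneg a) (norm_nonneg b) two_ne_zero⟩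

variable {X : Type*} [NormedAddCommGroup X] [InnerProductSpace ℝ X] {e r : X → ℝ} {β μ : ℝ}
  {p q x y g : X}

theorem surrogate_ofReal_of_mem_subdiff (e : X → ℝ) (β μ : ℝ) (y : X)
    (hp : p ∈ subdiff (ofReal r) x) :
    surrogate (ofReal e) (ofReal r) β μ (WithLp.toLp 2 (y, p)) =
      ((β * r y + e y + μ * realBregman r p y x : ℝ) : EReal) := by
  simp only [surrogate, WithLp.toLp_fst, WithLp.toLp_snd, conj_ofReal_eq_of_mem_subdiff hp, ofReal,
    ← EReal.coe_mul, ← EReal.coe_add, ← EReal.coe_sub, EReal.coe_eq_coe_iff]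
  rw [realBregman, inner_sub_right, real_inner_comm x p, real_inner_comm y p]
  ring

theorem le_surrogate_ofReal (e r : X → ℝ) (β : ℝ) (hμ : 0 ≤ μ) (x : X) (s : WithLp 2 (X × X)) :
    ((e s.fst + (β + μ) * r s.fst + μ * (⟪x, s.snd⟫_ℝ - r x) - μ * ⟪s.fst, s.snd⟫_ℝ : ℝ) : EReal)
      ≤ surrogate (ofReal e) (ofReal r) β μ s := by
  rw [EReal.coe_sub, EReal.coe_add, EReal.coe_add, EReal.coe_mul, EReal.coe_mul μ (_ - _)]
  refine EReal.sub_le_sub (add_le_add le_rfl ?_) le_rfl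
  exact mul_le_mul_of_nonneg_left (le_conj_ofReal r x s.snd) (EReal.coe_nonneg.2 hμ)

theorem hasFDerivAt_surrogate_minorant [CompleteSpace X] (hg : HasGradientAt e g y) (c : ℝ)
    (p q x : X) :
    HasFDerivAt (fun s : WithLp 2 (X × X) => e s.fst + ⟪q, s.fst⟫_ℝ + μ * ⟪x, s.snd⟫_ℝ
        - μ * ⟪s.fst, s.snd⟫_ℝ + c)
      (innerSL ℝ (WithLp.toLp 2 (g + q - μ • p, μ • (x - y)))) (WithLp.toLp 2 (y, p)) := by
  have hfst : HasFDerivAt (fun s : WithLp 2 (X × X) => s.fst) (WithLp.fstL 2 ℝ X X)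
    (WithLp.toLp 2 (y, p)) := (WithLp.fstL 2 ℝ X X).hasFDerivAt
  have hsnd : HasFDerivAt (fun s : WithLp 2 (X × X) => s.snd) (WithLp.sndL 2 ℝ X X)
    (WithLp.toLp 2 (y, p)) := (WithLp.sndL 2 ℝ X X).hasFDerivAt
  refine (((((hg.hasFDerivAt.comp (WithLp.toLp 2 (y, p)) hfst).add
    ((innerSL ℝ q).hasFDerivAt.comp _ hfst)).add
    (((innerSL ℝ x).hasFDerivAt.comp _ hsnd).const_mul μ)).sub
    ((hfst.inner ℝ hsnd).const_mul μ)).add_const c).congr_fderiv ?_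
  ext s
  simp only [WithLp.toLp_fst, WithLp.toLp_snd, sub_apply, add_apply,
    ContinuousLinearMap.comp_apply, WithLp.fstL_apply, InnerProductSpace.toDual_apply_apply,
    coe_innerSL_apply, smul_apply, WithLp.sndL_apply, smul_eq_mul, ContinuousLinearMap.prod_apply,
    fderivInnerCLM_apply, WithLp.prod_inner_apply, WithLp.ofLp_fst, inner_sub_left,
    inner_add_left, real_inner_smul_left, WithLp.ofLp_snd]
  rw [real_inner_comm p]
  ring

theorem mem_frechetSubdiff_surrogate [CompleteSpace X] (hβ : 0 ≤ β) (hμ : 0 ≤ μ)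
    (hg : HasGradientAt e g y) (hp : p ∈ subdiff (ofReal r) x) (hq : q ∈ subdiff (ofReal r) y) :
    WithLp.toLp 2 (g + (β + μ) • q - μ • p, μ • (x - y)) ∈
      frechetSubdiff (surrogate (ofReal e) (ofReal r) β μ) (WithLp.toLp 2 (y, p)) := by
  refine mem_frechetSubdiff_of_hasFDerivAt
    (hasFDerivAt_surrogate_minorant hg ((β + μ) * (r y - ⟪q, y⟫_ℝ) - μ * r x) p ((β + μ) • q) x)
    (fun s => ?_) ?_
  · refine le_trans (EReal.coe_le_coe_iff.2 ?_) (le_surrogate_ofReal e r β hμ x s)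
    have hsubgrad := mul_nonneg (add_nonneg hβ hμ) (mem_subdiff_ofReal.1 hq s.fst)
    rw [realBregman, inner_sub_right] at hsubgrad
    rw [real_inner_smul_left]
    linarith
  · rw [surrogate_ofReal_of_mem_subdiff e β μ y hp, EReal.coe_eq_coe_iff, realBregman,
      inner_sub_right, real_inner_smul_left, real_inner_comm x p, real_inner_comm y p]
    simp only [WithLp.toLp_fst, WithLp.toLp_snd]
    ring

end Surrogate

section GradLipschitz

variable {X : Type*} [NormedAddCommGroup X] [InnerProductSpace ℝ X] [FiniteDimensional ℝ X]
  {f : X → ℝ}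

theorem IsLocallyGradLipschitz.differentiable (hf : IsLocallyGradLipschitz (ofReal f)) :
    Differentiable ℝ f := fun x => by simpa using hf.1 x

theorem IsLocallyGradLipschitz.exists_norm_gradient_sub_le
    (hf : IsLocallyGradLipschitz (ofReal f)) {U : Set X} (hU : Bornology.IsBounded U) :
    ∃ C > 0, ∀ x ∈ U, ∀ y ∈ U, ‖∇ f x - ∇ f y‖ ≤ C * ‖x - y‖ := by
  simpa using hf.2 U hU

theorem IsLocallyGradLipschitz.continuous_gradient (hf : IsLocallyGradLipschitz (ofReal f)) :
    Continuous (∇ f) := by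
  refine continuous_iff_continuousAt.2 fun x => ?_
  obtain ⟨C, -, hC⟩ := hf.exists_norm_gradient_sub_le (Metric.isBounded_ball (x := x) (r := 1))
  refine tendsto_iff_norm_sub_tendsto_zero.2 (squeeze_zero' (t₀ := 𝓝 x)
    (g := fun y => C * ‖y - x‖) (Eventually.of_forall fun y => norm_nonneg _) ?_ ?_)
  · filter_upwards [Metric.ball_mem_nhds x one_pos] with y hy
    exact hC y hy x (Metric.mem_ball_self one_pos)
  · simpa using (tendsto_iff_norm_sub_tendsto_zero.1 (tendsto_id (x := 𝓝 x))).const_mul C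

end GradLipschitz

section Sequences

variable {X : Type*} [NormedAddCommGroup X] [NormedSpace ℝ X]

theorem eq_zero_of_tendsto_sub_of_isBounded {u : ℕ → X} {v : X}
    (hu : Bornology.IsBounded (Set.range u))
    (hv : Tendsto (fun k => u (k + 1) - u k) atTop (𝓝 v)) : v = 0 := by
  obtain ⟨P, hP⟩ := hu.exists_norm_le
  have hmean := hv.cesaro_smul
  simp only [Finset.sum_range_sub] at hmean
  have hinv : Tendsto (fun n : ℕ => (n : ℝ)⁻¹ * (P + P)) atTop (𝓝 0) := by
    simpa using (tendsto_inv_atTop_nhds_zero_nat (𝕜 := ℝ)).mul_const (P + P)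
  refine tendsto_nhds_unique hmean (squeeze_zero_norm (fun n => ?_) hinv)
  rw [norm_smul, norm_inv, Real.norm_natCast]
  gcongr
  exact norm_sub_le_of_le (hP _ ⟨n, rfl⟩) (hP _ ⟨0, rfl⟩)

theorem tendsto_zero_of_le_mul_add {a b : ℕ → ℝ} {q : ℝ} (ha : ∀ k, 0 ≤ a k) (hq : 0 ≤ q)
    (hq1 : q < 1) (hb : Tendsto b atTop (𝓝 0)) (hle : ∀ k, a (k + 1) ≤ q * a k + b k) :
    Tendsto a atTop (𝓝 0) := by
  refine tendsto_order.2 ⟨fun c hc => Eventually.of_forall fun k => hc.trans_le (ha k),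
    fun c hc => ?_⟩
  obtain ⟨N, hN⟩ := eventually_atTop.1
    (hb.eventually_le_const (show 0 < (1 - q) * (c / 2) by have := sub_pos.2 hq1; positivity))
  have hgeom : ∀ n, a (n + N) ≤ c / 2 + q ^ n * a N := by
    intro n
    induction n with
    | zero => simpa using (half_pos hc).le
    | succ n ih =>
      calc a (n + 1 + N) = a (n + N + 1) := by rw [Nat.add_right_comm]
        _ ≤ q * (c / 2 + q ^ n * a N) + (1 - q) * (c / 2) :=
          (hle _).trans (by gcongr; exact hN _ (Nat.le_add_left N n))
        _ = c / 2 + q ^ (n + 1) * a N := by ring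
  have hdecay : ∀ᶠ n in atTop, q ^ n * a N < c / 2 := by
    refine Tendsto.eventually_lt_const (half_pos hc) ?_
    simpa using (tendsto_pow_atTop_nhds_zero_of_lt_one hq hq1).mul_const (a N)
  rw [← map_add_atTop_eq_nat N, eventually_map]
  filter_upwards [hdecay] with n hn
  linarith [hgeom n]

theorem tendsto_of_tendsto_smul_sub_smul {β μ : ℝ} (hβ : 0 < β) (hμ : 0 ≤ μ) {u : ℕ → X} {v : X}
    (hv : Tendsto (fun k => (β + μ) • u (k + 1) - μ • u k) atTop (𝓝 v)) :
    Tendsto u atTop (𝓝 (β⁻¹ • v)) := by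
  have hβμ : 0 < β + μ := add_pos_of_pos_of_nonneg hβ hμ
  refine tendsto_iff_norm_sub_tendsto_zero.2 (tendsto_zero_of_le_mul_add (q := μ / (β + μ))
    (fun k => norm_nonneg _) (by positivity) ((div_lt_one hβμ).2 (by linarith))
    (b := fun k => (β + μ)⁻¹ * ‖(β + μ) • u (k + 1) - μ • u k - v‖) ?_ fun k => ?_)
  · simpa using (tendsto_iff_norm_sub_tendsto_zero.1 hv).const_mul (β + μ)⁻¹
  · have hsplit : u (k + 1) - β⁻¹ • v = (μ / (β + μ)) • (u k - β⁻¹ • v)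
        + (β + μ)⁻¹ • ((β + μ) • u (k + 1) - μ • u k - v) := by
      match_scalars <;> field_simp <;> ring
    rw [hsplit]
    refine norm_add_le_of_le ?_ ?_
    · rw [norm_smul, Real.norm_of_nonneg (by positivity)]
    · rw [norm_smul, Real.norm_of_nonneg (by positivity)]

end Sequences

theorem exists_tendsto_of_subdiff_subsingleton {X : Type*} [NormedAddCommGroup X]
    [InnerProductSpace ℝ X] [FiniteDimensional ℝ X] {r : X → ℝ} (hr : Continuous r)
    {x p : ℕ → X} {xs : X} (hx : Tendsto x atTop (𝓝 xs))
    (hp : ∀ k, p k ∈ subdiff (ofReal r) (x k)) (hbdd : Bornology.IsBounded (Set.range p))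
    (hss : (subdiff (ofReal r) xs).Subsingleton) : ∃ ps, Tendsto p atTop (𝓝 ps) := by
  have hK : IsCompact (closure (Set.range p)) := hbdd.isCompact_closure
  have hmem : ∀ k, p k ∈ closure (Set.range p) := fun k => subset_closure ⟨k, rfl⟩
  have hcluster : ∀ q, MapClusterPt q atTop p → q ∈ subdiff (ofReal r) xs := fun q hq => by
    obtain ⟨κ, hκ, hlim⟩ := hq.tendsto_subseq
    exact mem_subdiff_ofReal_of_tendsto hr (hx.comp hκ.tendsto_atTop) hlim fun k => hp _
  obtain ⟨ps, -, hps⟩ := hK.exists_mapClusterPt (f := atTop) (u := p)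
    (tendsto_principal.2 (Eventually.of_forall hmem))
  exact ⟨ps, hK.tendsto_nhds_of_unique_mapClusterPt (Eventually.of_forall hmem)
    fun q _ hq => hss (hcluster q hq) (hcluster ps hps)⟩

section SurrogateDescent

variable {X : Type*} [NormedAddCommGroup X] [InnerProductSpace ℝ X]

/-- The points `(x (k + 1), p k)` at which the surrogate is evaluated. -/
noncomputable def surrogatePoint (x p : ℕ → X) (k : ℕ) : WithLp 2 (X × X) :=
  WithLp.toLp 2 (x (k + 1), p k)

/-- The value of the surrogate at `(x (k + 1), p k)` when `p k` is a subgradient of `r` at `x k`. -/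
noncomputable def surrogateValue (e r : X → ℝ) (β μ : ℝ) (x p : ℕ → X) (k : ℕ) : ℝ :=
  β * r (x (k + 1)) + e (x (k + 1)) + μ * realBregman r (p k) (x (k + 1)) (x k)

variable [FiniteDimensional ℝ X] {e r : X → ℝ} {β μ a b c : ℝ} {ε : ℕ → ℝ} {x p : ℕ → X}

/-- What the convergence analysis uses of the iteration: bounded iterates and subgradients,
sufficient decrease of `β r + e`, and inexact stationarity with summable errors `ε`. -/
structure IsSurrogateDescent (e r : X → ℝ) (β μ a b : ℝ) (ε : ℕ → ℝ) (x p : ℕ → X) : Prop where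
  a_pos : 0 < a
  b_nonneg : 0 ≤ b
  mem_subdiff : ∀ k, p k ∈ subdiff (ofReal r) (x k)
  isBounded_x : Bornology.IsBounded (Set.range x)
  isBounded_p : Bornology.IsBounded (Set.range p)
  error_nonneg : ∀ k, 0 ≤ ε k
  summable_error : Summable ε
  decrease : ∀ k, β * r (x (k + 1)) + e (x (k + 1)) + μ * realBregman r (p k) (x (k + 1)) (x k)
    + a * ‖x (k + 1) - x k‖ ^ 2 ≤ β * r (x k) + e (x k)
  norm_le : ∀ k, ‖∇ e (x k) + (β + μ) • p (k + 1) - μ • p k‖ ≤ b * ‖x (k + 1) - x k‖ + ε k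

namespace IsSurrogateDescent

theorem realBregman_nonneg (h : IsSurrogateDescent e r β μ a b ε x p) (k : ℕ) :
    0 ≤ realBregman r (p k) (x (k + 1)) (x k) :=
  mem_subdiff_ofReal.1 (h.mem_subdiff k) _

theorem exists_isInexactDescent (h : IsSurrogateDescent e r β μ a b ε x p) (hβ : 0 ≤ β)
    (hμ : 0 < μ) (he : IsLocallyGradLipschitz (ofReal e)) :
    ∃ w b', IsInexactDescent (surrogate (ofReal e) (ofReal r) β μ) (surrogatePoint x p) w
      (surrogateValue e r β μ x p) (fun k => ‖x (k + 1) - x k‖) ε a b' := by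
  obtain ⟨C, hC, hlip⟩ := he.exists_norm_gradient_sub_le h.isBounded_x
  refine ⟨fun k => WithLp.toLp 2 (∇ e (x (k + 1)) + (β + μ) • p (k + 1) - μ • p k,
    μ • (x k - x (k + 1))), C + b + μ,
    { a_pos := h.a_pos
      b_pos := by linarith [h.b_nonneg]
      value := fun k => surrogate_ofReal_of_mem_subdiff e β μ _ (h.mem_subdiff k)
      mem_frechetSubdiff := fun k => mem_frechetSubdiff_surrogate hβ hμ.le
        (he.differentiable _).hasGradientAt (h.mem_subdiff k) (h.mem_subdiff (k + 1))
      step_nonneg := fun k => norm_nonneg _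
      error_nonneg := h.error_nonneg
      summable_error := h.summable_error
      decrease := fun k => (h.decrease (k + 1)).trans
        (le_add_of_nonneg_right (mul_nonneg hμ.le (h.realBregman_nonneg k)))
      norm_le := fun k => ?_ }⟩
  have hfst : ‖∇ e (x (k + 1)) + (β + μ) • p (k + 1) - μ • p k‖ ≤
      C * ‖x (k + 1) - x k‖ + (b * ‖x (k + 1) - x k‖ + ε k) := by
    rw [show ∇ e (x (k + 1)) + (β + μ) • p (k + 1) - μ • p k = ∇ e (x (k + 1)) - ∇ e (x k)
      + (∇ e (x k) + (β + μ) • p (k + 1) - μ • p k) by abel]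
    exact norm_add_le_of_le (hlip _ ⟨k + 1, rfl⟩ _ ⟨k, rfl⟩) (h.norm_le k)
  have hsnd : ‖μ • (x k - x (k + 1))‖ = μ * ‖x (k + 1) - x k‖ := by
    rw [norm_smul, Real.norm_of_nonneg hμ.le, norm_sub_rev]
  linarith [norm_toLp_le (∇ e (x (k + 1)) + (β + μ) • p (k + 1) - μ • p k)
    (μ • (x k - x (k + 1)))]

theorem bddBelow_surrogateValue (h : IsSurrogateDescent e r β μ a b ε x p) (hμ : 0 ≤ μ)
    (he : Continuous e) (hr : Continuous r) :
    BddBelow (Set.range (surrogateValue e r β μ x p)) := by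
  obtain ⟨l, hl⟩ := h.isBounded_x.isCompact_closure.bddBelow_image
    (f := fun z => β * r z + e z) (by fun_prop)
  refine ⟨l, Set.forall_mem_range.2 fun k => ?_⟩
  exact (hl ⟨x (k + 1), subset_closure ⟨k + 1, rfl⟩, rfl⟩).trans
    (le_add_of_nonneg_right (mul_nonneg hμ (h.realBregman_nonneg k)))

theorem surrogate_eq_of_mapClusterPt (h : IsSurrogateDescent e r β μ a b ε x p)
    (he : Continuous e) (hr : Continuous r)
    (hstep : Tendsto (fun k => ‖x (k + 1) - x k‖) atTop (𝓝 0))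
    (hv : Tendsto (surrogateValue e r β μ x p) atTop (𝓝 c)) {z : WithLp 2 (X × X)}
    (hz : MapClusterPt z atTop (surrogatePoint x p)) :
    surrogate (ofReal e) (ofReal r) β μ z = c := by
  obtain ⟨κ, hκ, hlim⟩ := hz.tendsto_subseq
  have hsucc : Tendsto (fun k => x (κ k + 1)) atTop (𝓝 z.fst) :=
    ((WithLp.fstL 2 ℝ X X).continuous.tendsto z).comp hlim
  have hp : Tendsto (fun k => p (κ k)) atTop (𝓝 z.snd) :=
    ((WithLp.sndL 2 ℝ X X).continuous.tendsto z).comp hlim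
  have hx : Tendsto (fun k => x (κ k)) atTop (𝓝 z.fst) := by
    simpa using hsucc.sub ((tendsto_zero_iff_norm_tendsto_zero.2 hstep).comp hκ.tendsto_atTop)
  have hmem : z.snd ∈ subdiff (ofReal r) z.fst :=
    mem_subdiff_ofReal_of_tendsto hr hx hp fun k => h.mem_subdiff _
  have hvz : Tendsto (fun k => surrogateValue e r β μ x p (κ k)) atTop
      (𝓝 (β * r z.fst + e z.fst + μ * realBregman r z.snd z.fst z.fst)) :=
    (((((hr.tendsto _).comp hsucc).const_mul β).add ((he.tendsto _).comp hsucc)).add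
      (((((hr.tendsto _).comp hsucc).sub ((hr.tendsto _).comp hx)).sub
        (hp.inner (hsucc.sub hx))).const_mul μ))
  rw [← tendsto_nhds_unique hvz (hv.comp hκ.tendsto_atTop)]
  exact surrogate_ofReal_of_mem_subdiff e β μ z.fst hmem

theorem summable_norm_sub (h : IsSurrogateDescent e r β μ a b ε x p) (hβ : 0 ≤ β) (hμ : 0 < μ)
    (he : IsLocallyGradLipschitz (ofReal e)) (hr : Continuous r)
    (hKL : IsKLFunction (surrogate (ofReal e) (ofReal r) β μ)) :
    Summable fun k => ‖x (k + 1) - x k‖ := by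
  obtain ⟨w, b', hdesc⟩ := h.exists_isInexactDescent hβ hμ he
  have hecont : Continuous e := he.differentiable.continuous
  have hv := tendsto_atTop_ciInf hdesc.antitone (h.bddBelow_surrogateValue hμ.le hecont hr)
  have hK : IsCompact (WithLp.toLp 2 '' (closure (Set.range x) ×ˢ closure (Set.range p))) :=
    (h.isBounded_x.isCompact_closure.prod h.isBounded_p.isCompact_closure).image
      (WithLp.prod_continuous_toLp 2 X X)
  exact hdesc.summable_step hv hK
    (fun k => Set.mem_image_of_mem _ ⟨subset_closure ⟨k + 1, rfl⟩, subset_closure ⟨k, rfl⟩⟩)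
    (fun z => h.surrogate_eq_of_mapClusterPt hecont hr (hdesc.tendsto_step hv) hv) hKL.kl

theorem tendsto_smul_sub_smul (h : IsSurrogateDescent e r β μ a b ε x p)
    (he : Continuous (∇ e)) (hstep : Tendsto (fun k => ‖x (k + 1) - x k‖) atTop (𝓝 0))
    {xs : X} (hx : Tendsto x atTop (𝓝 xs)) :
    Tendsto (fun k => (β + μ) • p (k + 1) - μ • p k) atTop (𝓝 (-∇ e xs)) := by
  have hres : Tendsto (fun k => ∇ e (x k) + (β + μ) • p (k + 1) - μ • p k) atTop (𝓝 0) :=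
    squeeze_zero_norm h.norm_le <| by
      simpa using (hstep.const_mul b).add h.summable_error.tendsto_atTop_zero
  simpa [add_sub_assoc] using hres.sub ((he.tendsto xs).comp hx)

theorem gradient_eq_zero (h : IsSurrogateDescent e r 0 μ a b ε x p) (hμ : 0 < μ)
    (he : Continuous (∇ e)) (hstep : Tendsto (fun k => ‖x (k + 1) - x k‖) atTop (𝓝 0))
    {xs : X} (hx : Tendsto x atTop (𝓝 xs)) : ∇ e xs = 0 := by
  have hdiff : Tendsto (fun k => p (k + 1) - p k) atTop (𝓝 (μ⁻¹ • -∇ e xs)) := by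
    simpa [← smul_sub, smul_smul, hμ.ne'] using
      (h.tendsto_smul_sub_smul he hstep hx).const_smul μ⁻¹
  simpa [hμ.ne'] using eq_zero_of_tendsto_sub_of_isBounded h.isBounded_p hdiff

theorem tendsto_p (h : IsSurrogateDescent e r β μ a b ε x p) (hβ : 0 < β) (hμ : 0 ≤ μ)
    (he : Continuous (∇ e)) (hstep : Tendsto (fun k => ‖x (k + 1) - x k‖) atTop (𝓝 0))
    {xs : X} (hx : Tendsto x atTop (𝓝 xs)) : Tendsto p atTop (𝓝 (β⁻¹ • -∇ e xs)) :=
  tendsto_of_tendsto_smul_sub_smul hβ hμ (h.tendsto_smul_sub_smul he hstep hx)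

theorem exists_stationary (h : IsSurrogateDescent e r β μ a b ε x p) (hβ : 0 ≤ β) (hμ : 0 < μ)
    (he : Continuous (∇ e)) (hr : Continuous r)
    (hstep : Tendsto (fun k => ‖x (k + 1) - x k‖) atTop (𝓝 0)) {xs : X}
    (hx : Tendsto x atTop (𝓝 xs)) (hne : (subdiff (ofReal r) xs).Nonempty) :
    ∃ q ∈ subdiff (ofReal r) xs, ∇ e xs + β • q = 0 ∧ (0 < β → Tendsto p atTop (𝓝 q)) := by
  rcases hβ.eq_or_lt with rfl | hβ
  · obtain ⟨q, hq⟩ := hne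
    exact ⟨q, hq, by simp [h.gradient_eq_zero hμ he hstep hx], fun hlt => (lt_irrefl 0 hlt).elim⟩
  · have hp := h.tendsto_p hβ hμ.le he hstep hx
    exact ⟨β⁻¹ • -∇ e xs, mem_subdiff_ofReal_of_tendsto hr hx hp h.mem_subdiff,
      by simp [smul_smul, hβ.ne'], fun _ => hp⟩

end IsSurrogateDescent

end SurrogateDescent

section Update

variable {X : Type*} [NormedAddCommGroup X] [InnerProductSpace ℝ X] {H r e : X → ℝ}
  {β d m : ℝ} {x y p q gx gy v : X}

theorem value_eq_of_update (H r e : X → ℝ)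
    (hupd : (m + β) • q = m • p - (1 / d) • (gy - gx) - v) :
    β * r x + e x = β * r y + e y + m * realBregman r p y x
      + 1 / d * (realBregman H gx y x + realBregman H gy x y) - realBregman e v y x
      + (m + β) * realBregman r q x y := by
  have hinner := congrArg (fun z => ⟪z, x - y⟫_ℝ) hupd
  simp only [realBregman, inner_sub_left, inner_sub_right, real_inner_smul_left] at hinner ⊢
  linear_combination hinner

theorem sufficient_decrease_of_update {α ω B c L : ℝ} (hd : 0 < d) (hdB : d ≤ B) (hω : 0 ≤ ω)
    (hc : 0 ≤ c) (hmβ : 0 ≤ m + β) (hLd : L * d ≤ 1 + α - ω)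
    (hH : c / 2 * ‖y - x‖ ^ 2 ≤ realBregman H gx y x)
    (hα : α * realBregman H gx y x ≤ realBregman H gy x y)
    (he : realBregman e v y x ≤ L * realBregman H gx y x) (hq : q ∈ subdiff (ofReal r) y)
    (hupd : (m + β) • q = m • p - (1 / d) • (gy - gx) - v) :
    β * r y + e y + m * realBregman r p y x + ω / B * (c / 2) * ‖y - x‖ ^ 2 ≤
      β * r x + e x := by
  have hHnonneg : 0 ≤ realBregman H gx y x := le_trans (by positivity) hH
  have hbreg : L * realBregman H gx y x + ω / B * (c / 2) * ‖y - x‖ ^ 2 ≤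
      1 / d * (realBregman H gx y x + realBregman H gy x y) :=
    calc L * realBregman H gx y x + ω / B * (c / 2) * ‖y - x‖ ^ 2
      _ ≤ L * realBregman H gx y x + ω / d * realBregman H gx y x := by
        rw [mul_assoc]
        gcongr
      _ = 1 / d * ((L * d + ω) * realBregman H gx y x) := by field_simp
      _ ≤ 1 / d * ((1 + α) * realBregman H gx y x) :=
        mul_le_mul_of_nonneg_left (mul_le_mul_of_nonneg_right (by linarith) hHnonneg)
          (one_div_pos.2 hd).le
      _ ≤ 1 / d * (realBregman H gx y x + realBregman H gy x y) := by gcongr; linarith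
  have hsubgrad := mul_nonneg hmβ (mem_subdiff_ofReal.1 hq x)
  linarith [value_eq_of_update H r e hupd (x := x) (y := y)]

-- The subproblem is `(m + β) r` plus a differentiable function, whose gradient at `y` is
-- `-(m + β) q`.
theorem mem_subdiff_of_update [CompleteSpace X] (hr : ConvexOn ℝ Set.univ r)
    (hH : HasGradientAt H gy y) (hmβ : 0 < m + β)
    (hupd : (m + β) • q = m • p - (1 / d) • (gy - gx) - v)
    (hmin : ∀ z, ⟪v, y - x⟫_ℝ + β * r y + 1 / d * realBregman H gx y x + m * realBregman r p y x ≤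
      ⟪v, z - x⟫_ℝ + β * r z + 1 / d * realBregman H gx z x + m * realBregman r p z x) :
    q ∈ subdiff (ofReal r) y := by
  set S : X → ℝ := fun z => ⟪v, z⟫_ℝ + 1 / d * (H z - ⟪gx, z⟫_ℝ) - m * ⟪p, z⟫_ℝ with hS
  have hgrad : HasGradientAt S (-((m + β) • q)) y := by
    rw [hasGradientAt_iff_hasFDerivAt]
    refine (((innerSL ℝ v).hasFDerivAt.add ((hH.hasFDerivAt.sub
      (innerSL ℝ gx).hasFDerivAt).const_mul (1 / d))).sub
      ((innerSL ℝ p).hasFDerivAt.const_mul m)).congr_fderiv ?_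
    ext z
    simp only [one_div, sub_apply, add_apply,
      coe_innerSL_apply, smul_apply, InnerProductSpace.toDual_apply_apply,
      smul_eq_mul, hupd, neg_sub, map_sub, map_smul]
    ring
  have hSmin : IsMinOn ((m + β) • r + S) Set.univ y := fun z _ => by
    have hz := hmin z
    simp only [realBregman, inner_sub_right] at hz
    simp only [Set.mem_ofPred_eq, Pi.add_apply, Pi.smul_apply, smul_eq_mul, hS]
    linarith
  have hnonneg := fun z => realBregman_neg_gradient_nonneg (hr.smul hmβ.le) hgrad hSmin
    (Set.mem_univ y) (Set.mem_univ z)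
  refine mem_subdiff_ofReal.2 fun z => (mul_nonneg_iff_of_pos_left hmβ).1 ?_
  simpa [realBregman, real_inner_smul_left, mul_sub] using hnonneg z

end Update

section Iteration

theorem isBounded_range_of_objective_le {X : Type*} [Bornology X] {r e : X → ℝ} {β : ℝ} {x : ℕ → X}
    (hx : ∀ k, β * r (x (k + 1)) + e (x (k + 1)) ≤ β * r (x k) + e (x k))
    (hlevel : Bornology.IsBounded {z | objective (ofReal e) (ofReal r) β z ≤
      objective (ofReal e) (ofReal r) β (x 0)}) : Bornology.IsBounded (Set.range x) := by
  refine hlevel.subset (Set.range_subset_iff.2 fun k => ?_)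
  rw [Set.mem_ofPred_eq, objective_ofReal, objective_ofReal, EReal.coe_le_coe_iff]
  exact antitone_nat_of_succ_le (f := fun k => β * r (x k) + e (x k)) hx (Nat.zero_le k)

variable {X : Type*} [NormedAddCommGroup X] [InnerProductSpace ℝ X] [FiniteDimensional ℝ X]
  {H r e : X → ℝ} {β μ L : ℝ} {δ m : ℕ → ℝ} {x p : ℕ → X}

theorem one_div_le_of_summable_sub {τ : ℝ} (hτ : 0 < τ) (hδ : ∀ k, 0 < δ k)
    (hδm : ∀ k, τ < δ k * m k) (hm : ∀ k, μ ≤ m k) (hsum : Summable fun k => m k - μ) (k : ℕ) :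
    1 / δ k ≤ (μ + ∑' k, (m k - μ)) / τ := by
  have hmk : m k ≤ μ + ∑' k, (m k - μ) := by
    linarith [hsum.le_tsum k fun j _ => sub_nonneg.2 (hm j)]
  rw [div_le_div_iff₀ (hδ k) hτ, one_mul]
  calc τ ≤ δ k * m k := (hδm k).le
    _ ≤ δ k * (μ + ∑' k, (m k - μ)) := by gcongr; exact (hδ k).le
    _ = (μ + ∑' k, (m k - μ)) * δ k := mul_comm _ _

namespace IsIteration

theorem smul_p_succ (hiter : IsIteration (ofReal H) (ofReal r) (ofReal e) β δ m x p) {k : ℕ}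
    (hmβ : m k + β ≠ 0) (hδ : δ k ≠ 0) :
    (m k + β) • p (k + 1) =
      m k • p k - (1 / δ k) • (∇ H (x (k + 1)) - ∇ H (x k)) - ∇ e (x k) := by
  rw [hiter.p_succ k]
  simp only [grad_ofReal]
  match_scalars <;> field_simp

theorem mem_subdiff (hiter : IsIteration (ofReal H) (ofReal r) (ofReal e) β δ m x p)
    (hr : ConvexOn ℝ Set.univ r) (hH : Differentiable ℝ H) (hmβ : ∀ k, 0 < m k + β)
    (hδ : ∀ k, δ k ≠ 0) : ∀ k, p k ∈ subdiff (ofReal r) (x k)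
  | 0 => hiter.p_zero
  | k + 1 => mem_subdiff_of_update hr (hH _).hasGradientAt (hmβ k)
      (hiter.smul_p_succ (hmβ k).ne' (hδ k)) fun z => by
        simpa only [subproblem_ofReal, EReal.coe_le_coe_iff] using hiter.x_succ k z

theorem sufficient_decrease {c ω : ℝ}
    (hiter : IsIteration (ofReal H) (ofReal r) (ofReal e) β δ m x p)
    (hr : ConvexOn ℝ Set.univ r) (hH : StrongConvexOn Set.univ c H) (hHd : Differentiable ℝ H)
    (hed : Differentiable ℝ e) (hLe : ConvexOn ℝ Set.univ fun z => L * H z - e z)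
    (hc : 0 ≤ c) (hL : 0 < L) (hω : 0 ≤ ω) (hmβ : ∀ k, 0 < m k + β)
    (hδ : ∀ k, 0 < δ k ∧ δ k < (1 + symmCoeff (ofReal H) - ω) / L) (k : ℕ) :
    β * r (x (k + 1)) + e (x (k + 1)) + m k * realBregman r (p k) (x (k + 1)) (x k)
      + ω / ((1 + symmCoeff (ofReal H) - ω) / L) * (c / 2) * ‖x (k + 1) - x k‖ ^ 2 ≤
        β * r (x k) + e (x k) :=
  sufficient_decrease_of_update (hδ k).1 (hδ k).2.le hω hc (hmβ k).le
    ((lt_div_iff₀' hL).1 (hδ k).2).le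
    (mul_sq_norm_sub_le_realBregman hH (hHd _).hasGradientAt (Set.mem_univ _) (Set.mem_univ _))
    (symmCoeff_mul_realBregman_le (hH.convexOn fun t => by positivity) hHd _ _)
    (realBregman_le_mul_realBregman hLe (hHd _).hasGradientAt (hed _).hasGradientAt
      (Set.mem_univ _) (Set.mem_univ _))
    (hiter.mem_subdiff hr hHd hmβ (fun j => (hδ j).1.ne') (k + 1))
    (hiter.smul_p_succ (hmβ k).ne' (hδ k).1.ne')

theorem norm_gradient_add_le (hiter : IsIteration (ofReal H) (ofReal r) (ofReal e) β δ m x p)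
    {k : ℕ} {T C P : ℝ} (hmβ : m k + β ≠ 0) (hδ : 0 < δ k) (hT : 1 / δ k ≤ T)
    (hC : ‖∇ H (x (k + 1)) - ∇ H (x k)‖ ≤ C * ‖x (k + 1) - x k‖) (hm : μ ≤ m k)
    (hP : ∀ k, ‖p k‖ ≤ P) :
    ‖∇ e (x k) + (β + μ) • p (k + 1) - μ • p k‖ ≤
      T * C * ‖x (k + 1) - x k‖ + (m k - μ) * (P + P) := by
  have hδ' : 0 ≤ 1 / δ k := (one_div_pos.2 hδ).le
  have hsplit : ∇ e (x k) + (β + μ) • p (k + 1) - μ • p k =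
      -((1 / δ k) • (∇ H (x (k + 1)) - ∇ H (x k))) - (m k - μ) • (p (k + 1) - p k) := by
    calc ∇ e (x k) + (β + μ) • p (k + 1) - μ • p k
      _ = ∇ e (x k) + (m k + β) • p (k + 1) - m k • p k
          - (m k - μ) • (p (k + 1) - p k) := by module
      _ = _ := by rw [hiter.smul_p_succ hmβ hδ.ne']; abel
  rw [hsplit]
  refine norm_sub_le_of_le ?_ ?_
  · rw [norm_neg, norm_smul, Real.norm_of_nonneg hδ', mul_assoc]
    exact mul_le_mul hT hC (norm_nonneg _) (hδ'.trans hT)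
  · rw [norm_smul, Real.norm_of_nonneg (sub_nonneg.2 hm)]
    exact mul_le_mul_of_nonneg_left (norm_sub_le_of_le (hP _) (hP _)) (sub_nonneg.2 hm)

theorem exists_isSurrogateDescent {c ω τ : ℝ}
    (hiter : IsIteration (ofReal H) (ofReal r) (ofReal e) β δ m x p)
    (hr : ConvexOn ℝ Set.univ r) (hsub : HasLocallyBoundedSubgradients (ofReal r))
    (hH : StrongConvexOn Set.univ c H) (hHlip : IsLocallyGradLipschitz (ofReal H))
    (he : Differentiable ℝ e) (hLe : ConvexOn ℝ Set.univ fun z => L * H z - e z)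
    (hlevel : Bornology.IsBounded {z | objective (ofReal e) (ofReal r) β z ≤
      objective (ofReal e) (ofReal r) β (x 0)})
    (hc : 0 < c) (hL : 0 < L) (hω : 0 < ω) (hβ : 0 ≤ β) (hμ : 0 < μ) (hτ : 0 < τ)
    (hδ : ∀ k, 0 < δ k ∧ δ k < (1 + symmCoeff (ofReal H) - ω) / L)
    (hδm : ∀ k, τ < δ k * m k) (hm : ∀ k, μ ≤ m k) (hsum : Summable fun k => m k - μ) :
    ∃ a b ε, IsSurrogateDescent e r β μ a b ε x p := by
  have hmβ : ∀ k, 0 < m k + β := fun k => add_pos_of_pos_of_nonneg (hμ.trans_le (hm k)) hβ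
  have hHdiff := hHlip.differentiable
  have hp := hiter.mem_subdiff hr hHdiff hmβ fun k => (hδ k).1.ne'
  have hbreg : ∀ k, 0 ≤ realBregman r (p k) (x (k + 1)) (x k) := fun k =>
    mem_subdiff_ofReal.1 (hp k) _
  have ha : 0 < ω / ((1 + symmCoeff (ofReal H) - ω) / L) * (c / 2) :=
    mul_pos (div_pos hω ((hδ 0).1.trans (hδ 0).2)) (half_pos hc)
  have hdecrease : ∀ k, β * r (x (k + 1)) + e (x (k + 1))
      + μ * realBregman r (p k) (x (k + 1)) (x k)
      + ω / ((1 + symmCoeff (ofReal H) - ω) / L) * (c / 2) * ‖x (k + 1) - x k‖ ^ 2 ≤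
        β * r (x k) + e (x k) := fun k => by
    linarith [hiter.sufficient_decrease hr hH hHdiff he hLe hc.le hL hω.le hmβ hδ k,
      mul_le_mul_of_nonneg_right (hm k) (hbreg k)]
  have hx : Bornology.IsBounded (Set.range x) := isBounded_range_of_objective_le (fun k => by
    linarith [hdecrease k, mul_nonneg hμ.le (hbreg k),
      mul_nonneg ha.le (sq_nonneg ‖x (k + 1) - x k‖)]) hlevel
  obtain ⟨P, hP, hpP⟩ := hsub _ hx
  replace hpP : ∀ k, ‖p k‖ ≤ P := fun k => hpP _ (Set.mem_range_self k) _ (hp k)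
  obtain ⟨C, hC, hlip⟩ := hHlip.exists_norm_gradient_sub_le hx
  have hT := one_div_le_of_summable_sub hτ (fun k => (hδ k).1) hδm hm hsum
  exact ⟨_, _, _,
    { a_pos := ha
      b_nonneg := mul_nonneg ((one_div_pos.2 (hδ 0).1).le.trans (hT 0)) hC.le
      mem_subdiff := hp
      isBounded_x := hx
      isBounded_p := isBounded_iff_forall_norm_le.2 ⟨P, Set.forall_mem_range.2 hpP⟩
      error_nonneg := fun k => mul_nonneg (sub_nonneg.2 (hm k)) (add_nonneg hP.le hP.le)
      summable_error := hsum.mul_right (P + P)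
      decrease := hdecrease
      norm_le := fun k => hiter.norm_gradient_add_le (hmβ k).ne' (hδ k).1 (hT k)
        (hlip _ (Set.mem_range_self _) _ (Set.mem_range_self _)) (hm k) hpP }⟩

end IsIteration

end Iteration

section BasicAssumption

variable {X : Type*} [NormedAddCommGroup X] [InnerProductSpace ℝ X] [FiniteDimensional ℝ X]
  {h R E : X → EReal} {β L : ℝ}

theorem BasicAssumption.exists_eq_ofReal
    (hbasic : BasicAssumption h R E β L) (hg : IsLocallyGradLipschitz h) :
    ∃ H r e, h = ofReal H ∧ R = ofReal r ∧ E = ofReal e := by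
  have hdom := hbasic.legendre.dom_eq_univ hg
  have hdomR : dom R = Set.univ := Set.eq_univ_of_forall fun z =>
    (hbasic.R_domSubdiff (by simp [hdom] : z ∈ interior (dom h))).some_mem.1
  have hdomE : dom E = Set.univ := Set.univ_subset_iff.1 (hdom ▸ hbasic.E_dom)
  exact ⟨_, _, _, (ofReal_realPart hbasic.legendre.properLscConvex.proper.1 hdom).symm,
    (ofReal_realPart hbasic.R_properLscConvex.proper.1 hdomR).symm,
    (ofReal_realPart hbasic.E_proper.1 hdomE).symm⟩

theorem BasicAssumption.subdiff_subsingleton (hbasic : BasicAssumption h R E β L)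
    (hg : IsLocallyGradLipschitz h) (hc : IsLocallyStronglyConvex (conj R)) (x : X) :
    (subdiff R x).Subsingleton := by
  obtain ⟨_, _, _, -, rfl, -⟩ := hbasic.exists_eq_ofReal hg
  exact subdiff_ofReal_subsingleton hc x

end BasicAssumption

end LBreIF

theorem theorem4p2_general {X : Type*} [NormedAddCommGroup X] [InnerProductSpace ℝ X]
    [FiniteDimensional ℝ X]
    (h R E : X → EReal) (β μ L : ℝ) (δ m : ℕ → ℝ) (x p : ℕ → X)
    (hbasic : LBreIF.BasicAssumption h R E β L)
    (hsub : LBreIF.HasLocallyBoundedSubgradients R)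
    (hgrad_h : LBreIF.IsLocallyGradLipschitz h)
    (hgrad_E : LBreIF.IsLocallyGradLipschitz E)
    (hKL : LBreIF.IsKLFunction (LBreIF.surrogate E R β μ))
    (hstrong : LBreIF.IsStronglyConvex h)
    (hlevel : Bornology.IsBounded
      {z : X | LBreIF.objective E R β z ≤ LBreIF.objective E R β (x 0)})
    (hδ : ∃ ω : ℝ, 0 < ω ∧ ∀ k, 0 < δ k ∧ δ k < (1 + LBreIF.symmCoeff h - ω) / L)
    (hδm : ∃ τ : ℝ, 0 < τ ∧ ∀ k, τ < δ k * m k)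
    (hμ : 0 < μ) (hm : ∀ k, μ ≤ m k) (hsum : Summable fun k => m k - μ)
    (hiter : LBreIF.IsIteration h R E β δ m x p) :
    Summable (fun k => ‖x (k + 1) - x k‖) ∧
    ∃ xs ∈ interior (LBreIF.dom h), Tendsto x atTop (𝓝 xs) ∧
      (∃ q ∈ LBreIF.subdiff R xs, LBreIF.grad E xs + β • q = 0) ∧
      (0 < β ∨ (LBreIF.subdiff R xs).Subsingleton → ∃ ps, Tendsto p atTop (𝓝 ps)) := by
  obtain ⟨H, r, e, rfl, rfl, rfl⟩ := hbasic.exists_eq_ofReal hgrad_h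
  obtain ⟨c, hc, hH⟩ := hstrong
  obtain ⟨ω, hω, hδ⟩ := hδ
  obtain ⟨τ, hτ, hδm⟩ := hδm
  have hrconv : ConvexOn ℝ Set.univ r := by simpa using hbasic.R_properLscConvex.convex
  have hr : Continuous r := hrconv.locallyLipschitz.continuous
  obtain ⟨a, b, ε, hdesc⟩ := hiter.exists_isSurrogateDescent hrconv hsub (by simpa using hH)
    hgrad_h hgrad_E.differentiable (by simpa using hbasic.lipschitzLike) hlevel hc hbasic.L_pos
    hω hbasic.β_nonneg hμ hτ hδ hδm hm hsum
  have hstep := hdesc.summable_norm_sub hbasic.β_nonneg hμ hgrad_E hr hKL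
  have : CompleteSpace X := FiniteDimensional.complete ℝ X
  obtain ⟨xs, hxs⟩ := cauchySeq_tendsto_of_complete
    (cauchySeq_of_summable_dist (hstep.congr fun k => (dist_eq_norm' (x k) _).symm))
  have hint : xs ∈ interior (LBreIF.dom (LBreIF.ofReal H)) := by simp
  obtain ⟨q, hq, hstat, hpq⟩ := hdesc.exists_stationary hbasic.β_nonneg hμ
    hgrad_E.continuous_gradient hr hstep.tendsto_atTop_zero hxs (hbasic.R_domSubdiff hint)
  refine ⟨hstep, xs, hint, hxs, ⟨q, hq, by simpa using hstat⟩, ?_⟩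
  rintro (hβ | hss)
  · exact ⟨q, hpq hβ⟩
  · exact LBreIF.exists_tendsto_of_subdiff_subsingleton hr hxs hdesc.mem_subdiff
      hdesc.isBounded_p hss

theorem theorem4p2 {X : Type*} [NormedAddCommGroup X] [InnerProductSpace ℝ X]
    [FiniteDimensional ℝ X]
    (h R E : X → EReal) (β μ L : ℝ) (δ m : ℕ → ℝ) (x p : ℕ → X)
    (hbasic : LBreIF.BasicAssumption h R E β L)
    (hvanish : LBreIF.BregmanVanish h R)
    (hsub : LBreIF.HasLocallyBoundedSubgradients R)
    (hgrad_h : LBreIF.IsLocallyGradLipschitz h)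
    (hgrad_E : LBreIF.IsLocallyGradLipschitz E)
    (hKL : LBreIF.IsKLFunction (LBreIF.surrogate E R β μ))
    (hstrong : LBreIF.IsStronglyConvex h)
    (hclosed : closure (LBreIF.dom h) = LBreIF.dom h)
    (hlevel : Bornology.IsBounded
      {z : X | LBreIF.objective E R β z ≤ LBreIF.objective E R β (x 0)})
    (hδ : ∃ ω : ℝ, 0 < ω ∧ ω < 1 + LBreIF.symmCoeff h ∧
      ∀ k, 0 < δ k ∧ δ k < (1 + LBreIF.symmCoeff h - ω) / L)
    (hδm : ∃ τ : ℝ, 0 < τ ∧ ∀ k, τ < δ (k + 1) * m (k + 1) ∧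
      δ (k + 1) * m (k + 1) ≤ δ k * m k)
    (hμ : 0 < μ) (hm : ∀ k, μ ≤ m k) (hsum : Summable (fun k => m k - μ))
    (hiter : LBreIF.IsIteration h R E β δ m x p) :
    Summable (fun k => ‖x (k + 1) - x k‖) ∧
    ∃ xs ∈ interior (LBreIF.dom h), Filter.Tendsto x Filter.atTop (nhds xs) ∧
      (β = 0 → LBreIF.grad E xs = 0) ∧
      (LBreIF.IsLocallyStronglyConvex (LBreIF.conj R) →
        (∃ ps : X, Filter.Tendsto p Filter.atTop (nhds ps)) ∧
        ∃ q ∈ LBreIF.subdiff R xs, LBreIF.grad E xs + β • q = 0) := by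
  obtain ⟨hstep, xs, hint, hxs, ⟨q, hq, hstat⟩, hp⟩ := theorem4p2_general h R E β μ L δ m x p
    hbasic hsub hgrad_h hgrad_E hKL hstrong hlevel (hδ.imp fun _ h => ⟨h.1, h.2.2⟩)
    (hδm.imp fun _ h => ⟨h.1, Nat.rec ((h.2 0).1.trans_le (h.2 0).2) fun k _ => (h.2 k).1⟩)
    hμ hm hsum hiter
  exact ⟨hstep, xs, hint, hxs, fun hβ => by simpa [hβ] using hstat, fun hlsc =>
    ⟨hp (.inr (hbasic.subdiff_subsingleton hgrad_h hlsc xs)), q, hq, hstat⟩⟩
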